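/- Let $P$ be a probability measure on $\mathbb R$ with distribution function $F$ and finite variance, and suppose that $P$ has a density $f$ (so $F$ is absolutely continuous). Put $J=\{x: 0<F(x)<1\}$ and $\omega=\inf\{x: F(x)=1\}$ ($\omega=+\infty$ if $F<1$ everywhere). For $\theta_1\in\mathbb R$, $\theta_2>0$ let $X_1^*,X_2^*,\dots$ be i.i.d. with distribution function $F((x-\theta_1)/\theta_2)$, and let $M_i^*=\max(X_1^*,\dots,X_i^*)$ be the partial maxima. For $n\ge 2$, the partial-maxima BLUE $L_{2,n}$ of $\theta_2$ is the statistic $\sum_{i=1}^n c_iM_i^*$, with real constants $c_i$ not depending on $(\theta_1,\theta_2)$, that is unbiased for $\theta_2$ for all $(\theta_1,\theta_2)$ and has, for all $(\theta_1,\theta_2)$, the smallest variance among all such unbiased linear statistics. **Theorem.** Assume that * $f$ is log-concave on $J$ (positive there, with $\log f$ concave), or $f$ is non-increasing on $J$; * for some real $\gamma,\delta$ with either $\delta=0$ and $\gamma<3/2$, or $\delta>0$ and $1/2<\gamma\le 1$, the limit $$\lim_{x\to\omega-}\frac{f(x)}{(1-F(x))^{\gamma}\,(-\log(1-F(x)))^{\delta}}$$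 exists and lies in $(0,\infty)$. Then for every $n\ge2$ the BLUE $L_{2,n}$ exists and its coefficient vector is unique. There is a constant $C$, depending only on $P$, such that $\operatorname{Var}(L_{2,n})\le C\,\theta_2^2/\log n$ for all $n\ge2$, $\theta_1\in\mathbb R$ and $\theta_2>0$. Moreover $L_{2,n}$ is consistent: $L_{2,n}\to\theta_2$ in probability as $n\to\infty$, for all $\theta_1\in\mathbb R$, $\theta_2>0$. **Examples.** All these assumptions hold, with the indicated exponents, for the following distribution functions: * power, $F(x)=x^{\lambda}$ on $(0,1)$, $\lambda>0$ ($\gamma=\delta=0$); * logistic, $F(x)=1/(1+e^{-x})$, $x\in\mathbb R$ ($\gamma=1$, $\delta=0$); * Pareto, $F(x)=1-x^{-a}$ on $(1,\infty)$, $a>2$ ($\gamma=1+1/a$, $\delta=0$); * negative exponential, $F(x)=e^{x}$ on $(-\infty,0)$ ($\gamma=\delta=0$); * Weibull, $F(x)=1-e^{-x^{c}}$ on $(0,\infty)$, $c\ge1$ ($\gamma=1$, $\delta=1-1/c$); * Gumbel, $F(x)=\exp(-e^{-x})$, $x\in\mathbb R$ ($\gamma=1$, $\delta=0$); * standard normal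 ($\gamma=1$, $\delta=1/2$). -/

import Mathlib

open MeasureTheory ProbabilityTheory Filter Topology Set

noncomputable section

/-- The law of `θ₁ + θ₂ X` for `X` with law `P`: if `P` has distribution function `F` and
`0 < θ₂`, this law has distribution function `x ↦ F ((x - θ₁) / θ₂)`. -/
def locScaleLaw (P : Measure ℝ) (θ₁ θ₂ : ℝ) : Measure ℝ :=
  P.map (fun x => θ₁ + θ₂ * x)

/-- The law of an i.i.d. sequence of observations (the coordinates of `ℕ → ℝ`) from the member
`(θ₁, θ₂)` of the location-scale family generated by `P`. The observations are numbered from 0. -/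
def sampleLaw (P : Measure ℝ) (θ₁ θ₂ : ℝ) : Measure (ℕ → ℝ) :=
  Measure.infinitePi (fun _ : ℕ => locScaleLaw P θ₁ θ₂)

/-- The linear statistic with coefficients `c` in the first `n` partial maxima
`max (x 0, …, x i)`, `i < n`. -/
def maxStat {n : ℕ} (c : Fin n → ℝ) (x : ℕ → ℝ) : ℝ :=
  ∑ i : Fin n, c i * partialSups x (i : ℕ)

/-- The linear statistic with coefficients `c` is unbiased for the scale parameter, whatever the
parameters are. -/
def IsScaleUnbiased (P : Measure ℝ) {n : ℕ} (c : Fin n → ℝ) : Prop :=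
  ∀ θ₁ θ₂ : ℝ, 0 < θ₂ →
    Integrable (maxStat c) (sampleLaw P θ₁ θ₂) ∧
      ∫ x, maxStat c x ∂(sampleLaw P θ₁ θ₂) = θ₂

/-- `c` is the coefficient vector of a best linear unbiased estimator of the scale parameter from
the first `n` partial maxima: it is unbiased, and it has minimal variance among the unbiased linear
statistics, whatever the parameters are. (Only used for a probability `P` with a finite second moment, so that
all the variances are those of square integrable variables.) -/
def IsScaleBLUE (P : Measure ℝ) {n : ℕ} (c : Fin n → ℝ) : Prop :=
  IsScaleUnbiased P c ∧
    ∀ d : Fin n → ℝ, IsScaleUnbiased P d → ∀ θ₁ θ₂ : ℝ, 0 < θ₂ →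
      Var[maxStat c; sampleLaw P θ₁ θ₂] ≤ Var[maxStat d; sampleLaw P θ₁ θ₂]

/-- The set where the distribution function lies strictly between 0 and 1. -/
def cdfSupport (P : Measure ℝ) : Set ℝ := {x | 0 < cdf P x ∧ cdf P x < 1}

/-- The upper end-point `inf {x | F x = 1}` of the support, `⊤` if `F < 1` everywhere. -/
def upperEnd (P : Measure ℝ) : EReal := sInf ((fun x : ℝ => (x : EReal)) '' {x | cdf P x = 1})

/-- The filter on `ℝ` of left neighbourhoods of the upper end-point (`atTop` if it is `⊤`). -/
def leftOfUpperEnd (P : Measure ℝ) : Filter ℝ :=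
  comap (fun x : ℝ => (x : EReal)) (𝓝[<] upperEnd P)

/-- `f` is positive with concave logarithm on `s`. -/
def LogConcaveOn (s : Set ℝ) (f : ℝ → ℝ) : Prop :=
  (∀ x ∈ s, 0 < f x) ∧ ConcaveOn ℝ s (fun x => Real.log (f x))

/-- The distribution `P` has a finite variance and the density `f`, which is log-concave or
non-increasing on the interval where `0 < F < 1`, and `f / ((1 - F) ^ γ * (-log (1 - F)) ^ δ)` has
a limit in `(0, ∞)` at the upper end-point, where `γ` and `δ` are in the admissible range. -/
structure ScaleAssumptions (P : Measure ℝ) (f : ℝ → ℝ) (γ δ : ℝ) : Prop where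
  finite_variance : MemLp id 2 P
  density_measurable : Measurable f
  density_nonneg : ∀ x, 0 ≤ f x
  density_eq : P = volume.withDensity (fun x => ENNReal.ofReal (f x))
  shape : LogConcaveOn (cdfSupport P) f ∨ AntitoneOn f (cdfSupport P)
  exponents : (δ = 0 ∧ γ < 3 / 2) ∨ (0 < δ ∧ 1 / 2 < γ ∧ γ ≤ 1)
  limit : ∃ L : ℝ, 0 < L ∧
    Tendsto (fun x => f x / ((1 - cdf P x) ^ γ * (-Real.log (1 - cdf P x)) ^ δ))
      (leftOfUpperEnd P) (𝓝 L)

/-- `F` is the distribution function of a probability measure that satisfies the assumptions with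
the exponents `γ` and `δ` (that measure is determined by `F`). -/
def IsCovered (F : ℝ → ℝ) (γ δ : ℝ) : Prop :=
  ∃ (P : Measure ℝ) (f : ℝ → ℝ), IsProbabilityMeasure P ∧ (∀ x, cdf P x = F x) ∧
    ScaleAssumptions P f γ δ

def powerCdf (l x : ℝ) : ℝ := if x ≤ 0 then 0 else if x < 1 then x ^ l else 1

def logisticCdf (x : ℝ) : ℝ := 1 / (1 + Real.exp (-x))

def paretoCdf (a x : ℝ) : ℝ := if x ≤ 1 then 0 else 1 - x ^ (-a)

def negExpCdf (x : ℝ) : ℝ := if x < 0 then Real.exp x else 1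

def weibullCdf (c x : ℝ) : ℝ := if x ≤ 0 then 0 else 1 - Real.exp (-x ^ c)

def gumbelCdf (x : ℝ) : ℝ := Real.exp (-Real.exp (-x))

def normalCdf (x : ℝ) : ℝ := cdf (gaussianReal 0 1) x

end

/-!
The proof rests on the spacings `Z i = M (i + 1) - M i` of the partial maxima `M i`. A linear
statistic is unbiased for the scale exactly when its coefficients have sum zero and its mean at the
member `P` is one (`isScaleUnbiased_iff`), so that it is a linear combination of spacings, and the
variances in the whole family are those at `P` times `θ₂ ^ 2`.

*Existence and uniqueness.* The unbiased statistics form an affine subspace of `L²` of finite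
dimension, all with the same mean, and the BLUE is the point of least norm. The coefficients are
determined by the statistic, as there is, for every `i`, an event of positive probability on which
`Z i` is the only spacing that differs from zero (`eq_zero_of_maxStat_ae_eq_zero`).

*Order of the variance.* Let `m i` be the mean of `Z i`. Two facts carry the proof.

* Distinct spacings are non-positively correlated (`lintegral_spacing_mul_le`). Both shapes of the
  density make the distribution function `F` log-concave (`ScaleAssumptions.cdf_four_point`). Given
  that `M (i + 1) = t`, the conditional mean of `Z i` is then increasing in `t`, while that of a
  later spacing is decreasing, and Chebyshev's association inequality applies.
* The second moment of `Z i` is at most a constant times `(i + 1) * m i ^ 2`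
  (`ScaleAssumptions.exists_integral_spacing_sq_le`). Writing both moments as integrals over levels,
  and using the tail probability `s = 1 - F x` as the variable of integration, the condition at the
  upper end-point shows that with `k = i + 1` the mean is at least of the order
  `k ^ (γ - 2) * (log k) ^ (-δ)` and the second moment at most of the order
  `k ^ (2 * γ - 3) * (log k) ^ (-2 * δ)`. This uses `γ < 3 / 2` and `0 ≤ δ` only.

Hence the unbiased statistic that gives `Z i` a weight proportional to `1 / ((i + 1) * m i)` has a
variance of at most the order of the inverse of the harmonic sum, that is, of `1 / log n`
(`ScaleAssumptions.exists_unbiased_variance_le`). The BLUE does at least as well, and its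
consistency follows from Chebyshev's inequality.

For the examples, a continuous distribution function that is differentiable off a countable set has
its derivative as a density, which leaves the shape and the limit to be checked. The normal
distribution needs Mills' ratio (`tendsto_normal_tail_div`).
-/

noncomputable section

/-! ### Reduction to the member with location zero and scale one -/

lemma partialSups_add_one_eq_max (x : ℕ → ℝ) (i : ℕ) :
    partialSups x (i + 1) = max (partialSups x i) (x (i + 1)) :=
  partialSups_succ x i

lemma measurable_partialSups_apply (i : ℕ) : Measurable fun x : ℕ → ℝ => partialSups x i := by
  induction i with
  | zero => simpa using measurable_pi_apply 0
  | succ i ih => simpa only [partialSups_add_one_eq_max] using ih.max (measurable_pi_apply (i + 1))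

lemma measurable_maxStat {n : ℕ} (c : Fin n → ℝ) : Measurable (maxStat c) :=
  Finset.measurable_sum _ fun i _ => (measurable_partialSups_apply i).const_mul (c i)

lemma partialSups_affine {a b : ℝ} (hb : 0 ≤ b) (x : ℕ → ℝ) (i : ℕ) :
    partialSups (fun j => a + b * x j) i = a + b * partialSups x i := by
  induction i with
  | zero => simp
  | succ i ih =>
    rw [partialSups_add_one_eq_max, partialSups_add_one_eq_max, ih, mul_max_of_nonneg _ _ hb,
      max_add_add_left]

lemma maxStat_affine {n : ℕ} (c : Fin n → ℝ) {a b : ℝ} (hb : 0 ≤ b) (x : ℕ → ℝ) :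
    maxStat c (fun j => a + b * x j) = a * ∑ i, c i + b * maxStat c x := by
  simp only [maxStat, partialSups_affine hb, Finset.mul_sum, ← Finset.sum_add_distrib]
  exact Finset.sum_congr rfl fun i _ => by ring

lemma maxStat_add {n : ℕ} (c d : Fin n → ℝ) (x : ℕ → ℝ) :
    maxStat (c + d) x = maxStat c x + maxStat d x := by
  simp [maxStat, add_mul, Finset.sum_add_distrib]

lemma maxStat_smul {n : ℕ} (a : ℝ) (c : Fin n → ℝ) (x : ℕ → ℝ) :
    maxStat (a • c) x = a * maxStat c x := by
  simp [maxStat, Finset.mul_sum, mul_assoc]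

variable {P : Measure ℝ} [IsProbabilityMeasure P]

/-- The law of an i.i.d. sequence with common law `P`. -/
abbrev iidLaw (P : Measure ℝ) : Measure (ℕ → ℝ) := Measure.infinitePi (fun _ : ℕ => P)

lemma sampleLaw_eq_map (P : Measure ℝ) [IsProbabilityMeasure P] (a b : ℝ) :
    sampleLaw P a b = (iidLaw P).map (fun x i => a + b * x i) := by
  have h := Measure.infinitePi_map_pi (μ := fun _ : ℕ => P) (f := fun _ x => a + b * x)
    (fun _ => by fun_prop)
  exact h.symm

lemma measurable_affine_sequence (a b : ℝ) :
    Measurable (fun (x : ℕ → ℝ) (i : ℕ) => a + b * x i) := by fun_prop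

instance (P : Measure ℝ) [IsProbabilityMeasure P] (a b : ℝ) :
    IsProbabilityMeasure (sampleLaw P a b) := by
  rw [sampleLaw_eq_map]
  exact Measure.isProbabilityMeasure_map (measurable_affine_sequence a b).aemeasurable

lemma memLp_coordinate (hP : MemLp id 2 P) (i : ℕ) :
    MemLp (fun x : ℕ → ℝ => x i) 2 (iidLaw P) :=
  hP.comp_measurePreserving (measurePreserving_eval_infinitePi (fun _ : ℕ => P) i)

lemma memLp_partialSups (hP : MemLp id 2 P) (i : ℕ) :
    MemLp (fun x : ℕ → ℝ => partialSups x i) 2 (iidLaw P) := by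
  induction i with
  | zero => simpa using memLp_coordinate hP 0
  | succ i ih =>
    have := ih.sup (memLp_coordinate hP (i + 1))
    refine this.congr_norm (measurable_partialSups_apply _).aestronglyMeasurable ?_
    refine ae_of_all _ fun x => ?_
    rw [partialSups_add_one_eq_max]; rfl

lemma memLp_maxStat (hP : MemLp id 2 P) {n : ℕ} (c : Fin n → ℝ) :
    MemLp (maxStat c) 2 (iidLaw P) :=
by
  have h := memLp_finsetSum Finset.univ
    (f := fun (i : Fin n) (x : ℕ → ℝ) => c i * partialSups x (i : ℕ)) (p := 2) (μ := iidLaw P)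
    fun i _ => (memLp_partialSups hP (i : ℕ)).const_mul (c i)
  exact h

lemma memLp_maxStat_sampleLaw (hP : MemLp id 2 P) {n : ℕ} (c : Fin n → ℝ) (a : ℝ) {b : ℝ}
    (hb : 0 ≤ b) : MemLp (maxStat c) 2 (sampleLaw P a b) := by
  have h : MemLp (fun x => a * ∑ i, c i + b * maxStat c x) 2 (iidLaw P) :=
    (memLp_const (a * ∑ i, c i)).add ((memLp_maxStat hP c).const_mul b)
  have e : (maxStat c ∘ fun (x : ℕ → ℝ) (i : ℕ) => a + b * x i)
      = fun x => a * ∑ i, c i + b * maxStat c x := funext fun x => maxStat_affine c hb x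
  rw [sampleLaw_eq_map]
  refine (memLp_map_measure_iff (measurable_maxStat c).aestronglyMeasurable
    (measurable_affine_sequence a b).aemeasurable).2 ?_
  rwa [e]

lemma integral_maxStat_sampleLaw (hP : MemLp id 2 P) {n : ℕ} (c : Fin n → ℝ) (a : ℝ) {b : ℝ}
    (hb : 0 ≤ b) :
    ∫ x, maxStat c x ∂(sampleLaw P a b) = a * ∑ i, c i + b * ∫ x, maxStat c x ∂(iidLaw P) := by
  rw [sampleLaw_eq_map, integral_map (measurable_affine_sequence a b).aemeasurable
    (measurable_maxStat c).aestronglyMeasurable]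
  simp only [maxStat_affine c hb]
  rw [integral_add (integrable_const _) (((memLp_maxStat hP c).integrable one_le_two).const_mul b),
    integral_const_mul (f := maxStat c) b, integral_const]
  simp

lemma variance_maxStat_sampleLaw {n : ℕ} (c : Fin n → ℝ) (a : ℝ) {b : ℝ}
    (hb : 0 ≤ b) :
    Var[maxStat c; sampleLaw P a b] = b ^ 2 * Var[maxStat c; iidLaw P] := by
  rw [sampleLaw_eq_map, variance_map (measurable_maxStat c).aemeasurable
    (measurable_affine_sequence a b).aemeasurable]
  have : (maxStat c ∘ fun (x : ℕ → ℝ) (i : ℕ) => a + b * x i)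
      = fun x => a * ∑ i, c i + b * maxStat c x := funext fun x => maxStat_affine c hb x
  rw [this, variance_const_add ((measurable_maxStat c).const_mul b).aestronglyMeasurable,
    variance_const_mul]

/-- Unbiasedness for the scale in the whole family amounts to two linear constraints at the member
`P`: the coefficients add up to zero, and the statistic has mean one. -/
lemma isScaleUnbiased_iff (hP : MemLp id 2 P) {n : ℕ} (c : Fin n → ℝ) :
    IsScaleUnbiased P c ↔ ∑ i, c i = 0 ∧ ∫ x, maxStat c x ∂(iidLaw P) = 1 := by
  constructor
  · intro h
    have h0 := (h 0 1 one_pos).2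
    have h1 := (h 1 1 one_pos).2
    rw [integral_maxStat_sampleLaw hP c _ zero_le_one] at h0 h1
    constructor <;> linarith
  · rintro ⟨h0, h1⟩ a b hb
    refine ⟨(memLp_maxStat_sampleLaw hP c a hb.le).integrable one_le_two, ?_⟩
    rw [integral_maxStat_sampleLaw hP c a hb.le, h0, h1]; ring

lemma isScaleBLUE_iff {n : ℕ} (c : Fin n → ℝ) :
    IsScaleBLUE P c ↔ IsScaleUnbiased P c ∧ ∀ d : Fin n → ℝ, IsScaleUnbiased P d →
      Var[maxStat c; iidLaw P] ≤ Var[maxStat d; iidLaw P] := by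
  refine and_congr_right fun _ => forall_congr' fun d => forall_congr' fun _ => ?_
  constructor
  · intro h
    simpa [variance_maxStat_sampleLaw] using h 0 1 one_pos
  · intro h a b hb
    rw [variance_maxStat_sampleLaw c a hb.le, variance_maxStat_sampleLaw d a hb.le]
    gcongr

/-! ### Spacings of the partial maxima and their moments -/

lemma lintegral_lintegral_mul_lintegral_swap {Ω : Type*} [MeasurableSpace Ω] {μ : Measure Ω}
    [SFinite μ] {f g : Ω × ℝ → ENNReal} (hf : Measurable f) (hg : Measurable g) :
    ∫⁻ x, (∫⁻ y, f (x, y)) * (∫⁻ z, g (x, z)) ∂μ =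
      ∫⁻ y, ∫⁻ z, ∫⁻ x, f (x, y) * g (x, z) ∂μ := by
  have hm : Measurable fun q : (Ω × ℝ) × ℝ => f (q.1.1, q.1.2) * g (q.1.1, q.2) := by fun_prop
  have e : ∀ x, (∫⁻ y, f (x, y)) * ∫⁻ z, g (x, z) = ∫⁻ y, ∫⁻ z, f (x, y) * g (x, z) := by
    intro x
    rw [← lintegral_mul_const _ (by fun_prop)]
    exact lintegral_congr fun y => (lintegral_const_mul _ (by fun_prop)).symm
  simp_rw [e]
  rw [lintegral_lintegral_swap hm.lintegral_prod_right'.aemeasurable]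
  refine lintegral_congr fun y => ?_
  rw [lintegral_lintegral_swap]
  exact (by fun_prop : Measurable fun q : Ω × ℝ => f (q.1, y) * g (q.1, q.2)).aemeasurable

/-- The `i`-th spacing of the sequence of partial maxima. -/
def spacing (i : ℕ) (x : ℕ → ℝ) : ℝ := partialSups x (i + 1) - partialSups x i

lemma spacing_nonneg (i : ℕ) (x : ℕ → ℝ) : 0 ≤ spacing i x :=
  sub_nonneg.2 (partialSups_monotone x (Nat.le_succ i))

lemma measurable_spacing (i : ℕ) : Measurable (spacing i) :=
  (measurable_partialSups_apply (i + 1)).sub (measurable_partialSups_apply i)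

lemma memLp_spacing (hP : MemLp id 2 P) (i : ℕ) : MemLp (spacing i) 2 (iidLaw P) :=
  (memLp_partialSups hP (i + 1)).sub (memLp_partialSups hP i)

/-- The event that the level `y` is passed for the first time by observation `i + 1`. -/
def crossing (i : ℕ) (y : ℝ) : Set (ℕ → ℝ) :=
  {x | partialSups x i ≤ y ∧ y < partialSups x (i + 1)}

lemma measurableSet_crossing_prod (i : ℕ) :
    MeasurableSet {p : (ℕ → ℝ) × ℝ | p.1 ∈ crossing i p.2} := by
  have h : ∀ j, Measurable fun p : (ℕ → ℝ) × ℝ => partialSups p.1 j := fun j =>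
    (measurable_partialSups_apply j).comp measurable_fst
  exact (measurableSet_le (h i) measurable_snd).inter (measurableSet_lt measurable_snd (h (i + 1)))

lemma measurableSet_crossing (i : ℕ) (y : ℝ) : MeasurableSet (crossing i y) :=
  (measurableSet_le (measurable_partialSups_apply i) measurable_const).inter
    (measurableSet_lt measurable_const (measurable_partialSups_apply (i + 1)))

lemma measurable_indicator_crossing (i : ℕ) : Measurable
    fun p : (ℕ → ℝ) × ℝ => (crossing i p.2).indicator (1 : (ℕ → ℝ) → ENNReal) p.1 := by
  have h : Measurable ({p : (ℕ → ℝ) × ℝ | p.1 ∈ crossing i p.2}.indicator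
      (fun _ => (1 : ENNReal))) := measurable_const.indicator (measurableSet_crossing_prod i)
  exact h

/-- A spacing is the length of the set of levels that are passed at its step. -/
lemma ofReal_spacing (i : ℕ) (x : ℕ → ℝ) :
    ENNReal.ofReal (spacing i x) =
      ∫⁻ y, (crossing i y).indicator (1 : (ℕ → ℝ) → ENNReal) x := by
  have : (fun y => (crossing i y).indicator (1 : (ℕ → ℝ) → ENNReal) x)
      = (Ico (partialSups x i) (partialSups x (i + 1))).indicator 1 := rfl
  rw [this, lintegral_indicator_one measurableSet_Ico, Real.volume_Ico]
  rfl

lemma lintegral_spacing (i : ℕ) :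
    ∫⁻ x, ENNReal.ofReal (spacing i x) ∂(iidLaw P) = ∫⁻ y, iidLaw P (crossing i y) := by
  simp_rw [ofReal_spacing]
  rw [lintegral_lintegral_swap (measurable_indicator_crossing i).aemeasurable]
  simp_rw [lintegral_indicator_one (measurableSet_crossing i _)]

lemma lintegral_spacing_mul (i j : ℕ) :
    ∫⁻ x, ENNReal.ofReal (spacing i x) * ENNReal.ofReal (spacing j x) ∂(iidLaw P)
      = ∫⁻ y, ∫⁻ z, iidLaw P (crossing i y ∩ crossing j z) := by
  simp_rw [ofReal_spacing]
  rw [lintegral_lintegral_mul_lintegral_swap (measurable_indicator_crossing i)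
    (measurable_indicator_crossing j)]
  refine lintegral_congr fun y => lintegral_congr fun z => ?_
  rw [← lintegral_indicator_one ((measurableSet_crossing i y).inter (measurableSet_crossing j z)),
    inter_indicator_one]
  rfl

lemma crossing_eq (i : ℕ) (y : ℝ) : crossing i y =
    Set.pi (Finset.range (i + 2)) fun k => if k ≤ i then Iic y else Ioi y := by
  ext x
  simp only [crossing, mem_ofPred_eq, partialSups_add_one_eq_max, partialSups_le_iff, Set.mem_pi,
    Finset.coe_range, mem_Iio, lt_max_iff]
  constructor
  · rintro ⟨h1, h2⟩ k hk
    split_ifs with h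
    · exact h1 k h
    · obtain rfl : k = i + 1 := by omega
      exact h2.resolve_left (not_lt.2 ((partialSups_le_iff).2 h1))
  · intro h
    refine ⟨fun k hk => ?_, Or.inr ?_⟩
    · simpa [hk] using h k (by omega)
    · simpa using h (i + 1) (by omega)

lemma iidLaw_pi_Iic_Ioi (i : ℕ) (y z : ℝ) :
    iidLaw P (Set.pi (Finset.range (i + 2)) fun k => if k ≤ i then Iic y else Ioi z)
      = P (Iic y) ^ (i + 1) * P (Ioi z) := by
  rw [Measure.infinitePi_pi]
  · rw [Finset.prod_range_succ]
    congr 1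
    · rw [Finset.prod_congr rfl (g := fun _ => P (Iic y))]
      · simp
      · intro k hk
        rw [if_pos (by simpa [Nat.lt_succ_iff] using hk)]
    · simp
  · intro k _; split_ifs; exacts [measurableSet_Iic, measurableSet_Ioi]

lemma measure_crossing (i : ℕ) (y : ℝ) :
    iidLaw P (crossing i y) = P (Iic y) ^ (i + 1) * P (Ioi y) := by
  rw [crossing_eq, iidLaw_pi_Iic_Ioi]

lemma measure_crossing_inter_self (i : ℕ) (y z : ℝ) :
    iidLaw P (crossing i y ∩ crossing i z) = P (Iic (min y z)) ^ (i + 1) * P (Ioi (max y z)) := by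
  rw [← iidLaw_pi_Iic_Ioi, crossing_eq, crossing_eq, ← Set.pi_inter_distrib]
  congr 2
  funext k
  by_cases hki : k ≤ i <;> simp [hki, Iic_inter_Iic, Ioi_inter_Ioi]

/-- If level `y` is passed for the first time by observation `i + 1` and level `z` by the later
observation `i + 1 + m + 1`, then `y` is below `z` and observation `i + 1` lies in `(y, z]`. (For
`z ≤ y` the interval, and with it the event, is empty.) -/
lemma measure_crossing_inter_le (i m : ℕ) (y z : ℝ) :
    iidLaw P (crossing i y ∩ crossing (i + 1 + m) z) ≤
      P (Iic y) ^ (i + 1) * P (Ioc y z) * P (Iic z) ^ m * P (Ioi z) := by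
  calc _ ≤ iidLaw P (Set.pi (Finset.range (i + 1 + 1 + m + 1)) fun k =>
          if k ≤ i then Iic y else if k = i + 1 then Ioc y z else
            if k ≤ i + 1 + m then Iic z else Ioi z) := by
          refine measure_mono ?_
          rw [crossing_eq, crossing_eq]
          rintro x ⟨h1, h2⟩ k hk
          have hk' : k < i + 1 + 1 + m + 1 := by simpa using hk
          have h2 := h2 k (by simp; omega)
          have h1 : k ≤ i + 1 → x k ∈ if k ≤ i then Iic y else Ioi y := fun hh =>
            h1 k (by simp; omega)
          dsimp only at h2 ⊢
          split_ifs with a b c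
          · simpa [a] using h1 (by omega)
          · subst b
            refine ⟨by simpa using h1 le_rfl, by simpa using h2⟩
          · simpa [c] using h2
          · simpa [c] using h2
    _ = _ := by
      rw [Measure.infinitePi_pi]
      · rw [Finset.prod_range_succ, Finset.prod_range_add, Finset.prod_range_succ]
        congr 1
        · congr 1
          · congr 1
            · rw [Finset.prod_congr rfl (g := fun _ => P (Iic y))]
              · simp
              · intro k hk
                rw [if_pos (by simpa [Nat.lt_succ_iff] using hk)]
            · simp
          · rw [Finset.prod_congr rfl (g := fun _ => P (Iic z))]
            · simp
            · intro k hk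
              have := Finset.mem_range.1 hk
              rw [if_neg (by omega), if_neg (by omega), if_pos (by omega)]
        · rw [if_neg (by omega), if_neg (by omega), if_neg (by omega)]
      · intro k _; split_ifs
        exacts [measurableSet_Iic, measurableSet_Ioc, measurableSet_Iic, measurableSet_Ioi]

/-! ### The probability integral transform -/

lemma continuous_cdf [NullSingletonClass P] : Continuous (cdf P) := by
  refine continuous_iff_continuousAt.2 fun x => ?_
  have hm : Monotone (cdf P) := monotone_cdf P
  rw [hm.continuousAt_iff_leftLim_eq_rightLim, (cdf P).rightLim_eq]
  have h : P {x} = 0 := measure_singleton x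
  rw [← measure_cdf P, StieltjesFunction.measure_singleton, ENNReal.ofReal_eq_zero] at h
  exact le_antisymm (hm.leftLim_le le_rfl) (by linarith)

lemma exists_cdf_eq [NullSingletonClass P] {u : ℝ} (h0 : 0 < u) (h1 : u < 1) : ∃ x, cdf P x = u := by
  obtain ⟨a, ha⟩ := ((tendsto_cdf_atBot P).eventually (gt_mem_nhds h0)).exists
  obtain ⟨b, hb⟩ := ((tendsto_cdf_atTop P).eventually (lt_mem_nhds h1)).exists
  exact mem_range_of_exists_le_of_exists_ge continuous_cdf ⟨a, ha.le⟩ ⟨b, hb.le⟩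

lemma measure_cdf_le [NullSingletonClass P] {u : ℝ} (h0 : 0 ≤ u) (h1 : u ≤ 1) :
    P {x | cdf P x ≤ u} = ENNReal.ofReal u := by
  apply le_antisymm
  · rcases h1.eq_or_lt with rfl | h1
    · simpa using prob_le_one
    refine ENNReal.le_of_forall_pos_le_add fun ε hε _ => ?_
    have hε' : (0 : ℝ) < ε := hε
    obtain ⟨b, hb⟩ := exists_cdf_eq (P := P) (u := min (u + ε) ((1 + u) / 2))
      (by positivity) (by rw [min_lt_iff]; right; linarith)
    have hub : u < cdf P b := by rw [hb, lt_min_iff]; constructor <;> linarith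
    calc P {x | cdf P x ≤ u} ≤ P (Iic b) := by
          refine measure_mono fun x hx => ?_
          by_contra hxb
          have := monotone_cdf P (not_le.1 hxb).le
          have hx : cdf P x ≤ u := hx
          linarith
      _ = ENNReal.ofReal (cdf P b) := (ofReal_cdf P b).symm
      _ ≤ ENNReal.ofReal (u + ε) := ENNReal.ofReal_le_ofReal (hb ▸ min_le_left _ _)
      _ ≤ _ := by rw [ENNReal.ofReal_add h0 hε'.le]; simp
  · rcases h0.eq_or_lt with rfl | h0
    · simp
    rcases h1.eq_or_lt with rfl | h1
    · simp [cdf_le_one]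
    obtain ⟨a, rfl⟩ := exists_cdf_eq (P := P) h0 h1
    rw [ofReal_cdf]
    exact measure_mono fun x hx => monotone_cdf P hx

/-- The **probability integral transform**: a continuous distribution function maps its
distribution to the uniform law. -/
lemma map_cdf [NullSingletonClass P] : P.map (cdf P) = volume.restrict (Icc 0 1) := by
  have hm : Measurable (cdf P) := (monotone_cdf P).measurable
  have : IsProbabilityMeasure (P.map (cdf P)) := Measure.isProbabilityMeasure_map hm.aemeasurable
  refine Measure.ext_of_Iic _ _ fun u => ?_
  rw [Measure.map_apply hm measurableSet_Iic, Measure.restrict_apply measurableSet_Iic]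
  change P {x | cdf P x ≤ u} = _
  rcases lt_or_ge u 0 with h0 | h0
  · have e1 : {x | cdf P x ≤ u} = ∅ := by
      ext x; simpa using h0.trans_le (cdf_nonneg P x)
    have e2 : Iic u ∩ Icc (0 : ℝ) 1 = ∅ := by
      ext x; simp only [mem_inter_iff, mem_Iic, mem_Icc, mem_empty_iff_false, iff_false]
      rintro ⟨h1, h2, -⟩; linarith
    simp [e1, e2]
  rcases le_total u 1 with h1 | h1
  · have e2 : Iic u ∩ Icc (0 : ℝ) 1 = Icc 0 u := by
      ext x; simp only [mem_inter_iff, mem_Iic, mem_Icc]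
      constructor
      · rintro ⟨h1, h2, -⟩; exact ⟨h2, h1⟩
      · rintro ⟨h2, h3⟩; exact ⟨h3, h2, h3.trans h1⟩
    rw [e2, measure_cdf_le h0 h1]; simp
  · have e1 : {x | cdf P x ≤ u} = univ := by
      ext x; simpa using (cdf_le_one P x).trans h1
    have e2 : Iic u ∩ Icc (0 : ℝ) 1 = Icc 0 1 := by
      ext x; simp only [mem_inter_iff, mem_Iic, mem_Icc, and_iff_right_iff_imp]
      rintro ⟨h2, h3⟩; linarith
    simp [e1, e2]

lemma map_one_sub_cdf [NullSingletonClass P] :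
    P.map (fun x => 1 - cdf P x) = volume.restrict (Icc 0 1) := by
  have hm : Measurable (cdf P) := (monotone_cdf P).measurable
  have h : P.map (fun x => 1 - cdf P x) = (P.map (cdf P)).map (fun u => 1 - u) :=
    (Measure.map_map (by fun_prop) hm).symm
  have h2 := ((Measure.measurePreserving_sub_left (volume : Measure ℝ) 1).restrict_preimage
    (s := Icc 0 1) measurableSet_Icc).map_eq
  have e : (fun x : ℝ => 1 - x) ⁻¹' Icc 0 1 = Icc 0 1 := by
    ext x; simp only [mem_preimage, mem_Icc]; constructor <;> rintro ⟨a, b⟩ <;> constructor <;> linarith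
  rw [e] at h2
  rw [h, map_cdf, h2]

lemma Iic_ae_eq_cdf_preimage [NullSingletonClass P] (y : ℝ) : Iic y =ᵐ[P] cdf P ⁻¹' Iic (cdf P y) := by
  refine ae_eq_of_subset_of_measure_ge (fun x hx => monotone_cdf P hx) ?_
    measurableSet_Iic.nullMeasurableSet (measure_ne_top _ _)
  rw [← ofReal_cdf]
  exact (measure_cdf_le (cdf_nonneg P y) (cdf_le_one P y)).le

lemma setLIntegral_Iic_pow [NullSingletonClass P] (a : ℕ) (y : ℝ) :
    ∫⁻ t in Iic y, P (Iic t) ^ a ∂P = ENNReal.ofReal (1 / (a + 1)) * P (Iic y) ^ (a + 1) := by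
  have hm : Measurable (cdf P) := (monotone_cdf P).measurable
  have h := cdf_nonneg P y
  rw [Measure.restrict_congr_set (Iic_ae_eq_cdf_preimage y)]
  simp_rw [← ofReal_cdf P]
  rw [← setLIntegral_map (f := fun u => ENNReal.ofReal u ^ a) measurableSet_Iic (by fun_prop) hm,
    map_cdf, Measure.restrict_restrict measurableSet_Iic]
  have e2 : Iic (cdf P y) ∩ Icc (0 : ℝ) 1 = Icc 0 (cdf P y) := by
    ext x; simp only [mem_inter_iff, mem_Iic, mem_Icc]
    constructor
    · rintro ⟨h1, h2, -⟩; exact ⟨h2, h1⟩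
    · rintro ⟨h2, h3⟩; exact ⟨h3, h2, h3.trans (cdf_le_one P y)⟩
  rw [e2, ← restrict_Ioc_eq_restrict_Icc,
    setLIntegral_congr_fun (g := fun u => ENNReal.ofReal (u ^ a)) measurableSet_Ioc
    (fun u hu => (ENNReal.ofReal_pow hu.1.le a).symm),
    ← ofReal_integral_eq_lintegral_ofReal, ← intervalIntegral.integral_of_le h, integral_pow,
    ← ENNReal.ofReal_pow h, ← ENNReal.ofReal_mul (by positivity)]
  · congr 1; rw [zero_pow (by omega)]; ring
  · exact ((continuous_pow a).integrableOn_Icc).mono_set Ioc_subset_Icc_self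
  · exact (ae_restrict_iff' measurableSet_Ioc).2 (ae_of_all _ fun u hu => pow_nonneg hu.1.le a)

lemma lintegral_cdf_pow [NullSingletonClass P] (a : ℕ) :
    ∫⁻ t, P (Iic t) ^ a ∂P = ENNReal.ofReal (1 / (a + 1)) := by
  have hm : Measurable (cdf P) := (monotone_cdf P).measurable
  simp_rw [← ofReal_cdf P]
  rw [← lintegral_map (f := fun u => ENNReal.ofReal u ^ a) (by fun_prop) hm, map_cdf,
    ← restrict_Ioc_eq_restrict_Icc,
    setLIntegral_congr_fun (g := fun u => ENNReal.ofReal (u ^ a)) measurableSet_Ioc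
    (fun u hu => (ENNReal.ofReal_pow hu.1.le a).symm),
    ← ofReal_integral_eq_lintegral_ofReal, ← intervalIntegral.integral_of_le zero_le_one,
    integral_pow]
  · congr 1; rw [zero_pow (by omega)]; ring
  · exact ((continuous_pow a).integrableOn_Icc).mono_set Ioc_subset_Icc_self
  · exact (ae_restrict_iff' measurableSet_Ioc).2 (ae_of_all _ fun u hu => pow_nonneg hu.1.le a)

/-! ### Log-concavity of the distribution function -/

lemma measurableSet_cdfSupport (P : Measure ℝ) : MeasurableSet (cdfSupport P) := by
  have hm : Measurable (cdf P) := (monotone_cdf P).measurable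
  exact (measurableSet_lt measurable_const hm).inter (measurableSet_lt hm measurable_const)

lemma ordConnected_cdfSupport (P : Measure ℝ) : (cdfSupport P).OrdConnected :=
  ⟨fun _ hx _ hy _ hz => ⟨hx.1.trans_le (monotone_cdf P hz.1),
    (monotone_cdf P hz.2).trans_lt hy.2⟩⟩

lemma measure_compl_cdfSupport [NullSingletonClass P] : P (cdfSupport P)ᶜ = 0 := by
  have hm : Measurable (cdf P) := (monotone_cdf P).measurable
  have : (cdfSupport P)ᶜ ⊆ cdf P ⁻¹' {0, 1} := by
    intro x hx
    rcases (cdf_nonneg P x).eq_or_lt with h | h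
    · exact Or.inl h.symm
    · exact Or.inr ((cdf_le_one P x).antisymm (not_lt.1 fun h' => hx ⟨h, h'⟩))
  refine measure_mono_null this ?_
  rw [← Measure.map_apply hm (by measurability), map_cdf]
  exact Measure.absolutelyContinuous_of_le Measure.restrict_le_self
    ((Set.toFinite {(0 : ℝ), 1}).measure_zero _)

/-- The values of the density outside `{0 < F < 1}`, about which the shape condition says nothing, may
be replaced by zero. -/
lemma withDensity_indicator_cdfSupport [NullSingletonClass P] {f : ℝ → ℝ}
    (hP : P = volume.withDensity fun x => ENNReal.ofReal (f x)) :
    P = volume.withDensity fun x => ENNReal.ofReal ((cdfSupport P).indicator f x) := by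
  have e : (fun x => ENNReal.ofReal ((cdfSupport P).indicator f x))
      = (cdfSupport P).indicator fun x => ENNReal.ofReal (f x) := by
    ext x; by_cases hx : x ∈ cdfSupport P <;> simp [hx]
  rw [e, withDensity_indicator (measurableSet_cdfSupport P),
    ← restrict_withDensity (measurableSet_cdfSupport P), ← hP,
    Measure.restrict_eq_self_of_ae_mem]
  exact measure_eq_zero_iff_ae_notMem.1 measure_compl_cdfSupport |>.mono fun x hx => by simpa using hx

lemma LogConcaveOn.mul_le_mul {s : Set ℝ} {f : ℝ → ℝ} (h : LogConcaveOn s f) {x y d : ℝ}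
    (hx : x ∈ s) (hy : y + d ∈ s) (hxy : x ≤ y) (hd : 0 ≤ d) :
    f x * f (y + d) ≤ f (x + d) * f y := by
  rcases (show x ≤ y + d by linarith).eq_or_lt with e | hlt
  · have : d = 0 := by linarith
    subst this
    simp [show x = y by linarith]
  set l := y + d - x with hl
  have hl0 : 0 < l := by linarith
  have c1 : x + d = (1 - d / l) • x + (d / l) • (y + d) := by
    simp only [smul_eq_mul]; field_simp; rw [hl]; ring
  have c2 : y = (d / l) • x + (1 - d / l) • (y + d) := by
    simp only [smul_eq_mul]; field_simp; rw [hl]; ring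
  have hd1 : 0 ≤ 1 - d / l := by
    rw [sub_nonneg, div_le_one hl0]; linarith
  have hd2 : 0 ≤ d / l := by positivity
  have i1 := h.2.2 hx hy hd1 hd2 (by ring)
  have i2 := h.2.2 hx hy hd2 hd1 (by ring)
  have m1 := h.2.1 hx hy hd1 hd2 (by ring)
  have m2 := h.2.1 hx hy hd2 hd1 (by ring)
  rw [← c1] at i1 m1
  rw [← c2] at i2 m2
  have p1 := h.1 _ hx
  have p2 := h.1 _ hy
  have p3 := h.1 _ m1
  have p4 := h.1 _ m2
  rw [← Real.log_le_log_iff (mul_pos p1 p2) (mul_pos p3 p4), Real.log_mul p1.ne' p2.ne',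
    Real.log_mul p3.ne' p4.ne']
  simp only [smul_eq_mul] at i1 i2
  linarith

lemma setLIntegral_Ioc_add_right (g : ℝ → ENNReal) (a b d : ℝ) :
    ∫⁻ z in Ioc (a + d) (b + d), g z = ∫⁻ z in Ioc a b, g (z + d) := by
  rw [← lintegral_indicator measurableSet_Ioc, ← lintegral_indicator measurableSet_Ioc,
    ← lintegral_add_right_eq_self _ d]
  refine lintegral_congr fun z => ?_
  simp [indicator]

lemma setLIntegral_Iic_add_right (g : ℝ → ENNReal) (b d : ℝ) :
    ∫⁻ z in Iic (b + d), g z = ∫⁻ z in Iic b, g (z + d) := by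
  rw [← lintegral_indicator measurableSet_Iic, ← lintegral_indicator measurableSet_Iic,
    ← lintegral_add_right_eq_self _ d]
  refine lintegral_congr fun z => ?_
  simp [indicator]

/-- For a log-concave density, the inequality `f w * f (z + d) ≤ f (w + d) * f z` is integrated over
`w ≤ u < z ≤ s`. -/
lemma cdf_four_point_of_logConcave [NullSingletonClass P] {f : ℝ → ℝ} (hf : Measurable f)
    (hP : P = volume.withDensity fun x => ENNReal.ofReal (f x))
    (h : LogConcaveOn (cdfSupport P) f) {u s d : ℝ} (hus : u ≤ s) (hd : 0 ≤ d) :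
    P (Iic u) * P (Iic (s + d)) ≤ P (Iic (u + d)) * P (Iic s) := by
  set g : ℝ → ENNReal := fun x => ENNReal.ofReal ((cdfSupport P).indicator f x) with hg
  have hgm : Measurable g := (hf.indicator (measurableSet_cdfSupport P)).ennreal_ofReal
  have hPg : P = volume.withDensity g := withDensity_indicator_cdfSupport hP
  have key : ∀ w z, w ≤ z → g w * g (z + d) ≤ g (w + d) * g z := by
    intro w z hwz
    by_cases h1 : w ∈ cdfSupport P
    · by_cases h2 : z + d ∈ cdfSupport P
      · have h3 := (ordConnected_cdfSupport P).out h1 h2 ⟨by linarith, by linarith⟩ (a := w + d)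
        have h4 := (ordConnected_cdfSupport P).out h1 h2 ⟨by linarith, by linarith⟩ (a := z)
        simp only [hg, indicator_of_mem h1, indicator_of_mem h2, indicator_of_mem h3,
          indicator_of_mem h4]
        rw [← ENNReal.ofReal_mul (h.1 _ h1).le, ← ENNReal.ofReal_mul (h.1 _ h3).le]
        exact ENNReal.ofReal_le_ofReal (h.mul_le_mul h1 h2 hwz hd)
      · simp [hg, indicator_of_notMem h2]
    · simp [hg, indicator_of_notMem h1]
  have ap : ∀ t, MeasurableSet t → P t = ∫⁻ x in t, g x := fun t ht => by
    conv_lhs => rw [hPg, withDensity_apply _ ht]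
  have split : ∀ a b, a ≤ b → P (Iic b) = P (Iic a) + P (Ioc a b) := fun a b hab => by
    rw [← Iic_union_Ioc_eq_Iic hab, measure_union _ measurableSet_Ioc]
    exact disjoint_left.2 fun x hx hx' => not_lt.2 hx hx'.1
  have main : P (Iic u) * P (Ioc (u + d) (s + d)) ≤ P (Iic (u + d)) * P (Ioc u s) := by
    rw [ap _ measurableSet_Iic, ap _ measurableSet_Ioc, ap _ measurableSet_Iic,
      ap _ measurableSet_Ioc, setLIntegral_Ioc_add_right, setLIntegral_Iic_add_right,
      ← lintegral_mul_const _ hgm, ← lintegral_mul_const _ (by fun_prop)]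
    refine setLIntegral_mono' measurableSet_Iic fun w hw => ?_
    rw [← lintegral_const_mul _ hgm, ← lintegral_const_mul _ (by fun_prop)]
    refine setLIntegral_mono' measurableSet_Ioc fun z hz => ?_
    exact key w z (le_trans hw hz.1.le)
  rw [split (u + d) (s + d) (by linarith), split u s hus, mul_add, mul_add]
  exact add_le_add (mul_comm _ _).le main

/-- For a non-increasing density, the probability of `(s, s + d]` is at most that of `(u, u + d]`, once
`u` is not below the support. -/
lemma cdf_four_point_of_antitone [NullSingletonClass P] {f : ℝ → ℝ}
    (hP : P = volume.withDensity fun x => ENNReal.ofReal (f x))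
    (h : AntitoneOn f (cdfSupport P)) {u s d : ℝ} (hus : u ≤ s) (hd : 0 ≤ d) :
    P (Iic u) * P (Iic (s + d)) ≤ P (Iic (u + d)) * P (Iic s) := by
  set g : ℝ → ENNReal := fun x => ENNReal.ofReal ((cdfSupport P).indicator f x) with hg
  have hPg : P = volume.withDensity g := withDensity_indicator_cdfSupport hP
  have ap : ∀ t, MeasurableSet t → P t = ∫⁻ x in t, g x := fun t ht => by
    conv_lhs => rw [hPg, withDensity_apply _ ht]
  have split : ∀ a b, a ≤ b → P (Iic b) = P (Iic a) + P (Ioc a b) := fun a b hab => by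
    rw [← Iic_union_Ioc_eq_Iic hab, measure_union _ measurableSet_Ioc]
    exact disjoint_left.2 fun x hx hx' => not_lt.2 hx hx'.1
  rcases eq_or_ne (P (Iic u)) 0 with h0 | h0
  · simp [h0]
  have hu : 0 < cdf P u := by
    rw [← ENNReal.ofReal_pos, ofReal_cdf]; exact h0.bot_lt
  have main : P (Ioc s (s + d)) ≤ P (Ioc u (u + d)) := by
    obtain ⟨e, he, rfl⟩ : ∃ e, 0 ≤ e ∧ s = u + e := ⟨s - u, by linarith, by ring⟩
    rw [ap _ measurableSet_Ioc, ap _ measurableSet_Ioc, show u + e + d = (u + d) + e by ring,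
      setLIntegral_Ioc_add_right]
    refine setLIntegral_mono' measurableSet_Ioc fun z hz => ?_
    by_cases h2 : z + e ∈ cdfSupport P
    · have h3 : z ∈ cdfSupport P := ⟨hu.trans_le (monotone_cdf P hz.1.le),
        (monotone_cdf P (by linarith)).trans_lt h2.2⟩
      simp only [hg, indicator_of_mem h2, indicator_of_mem h3]
      exact ENNReal.ofReal_le_ofReal (h h3 h2 (by linarith))
    · simp [hg, indicator_of_notMem h2]
  rw [split s (s + d) (by linarith), split u (u + d) (by linarith), mul_add, add_mul,
    mul_comm (P (Ioc u (u + d)))]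
  gcongr

lemma ScaleAssumptions.nullSingletonClass {P : Measure ℝ} {f : ℝ → ℝ} {γ δ : ℝ} (h : ScaleAssumptions P f γ δ) :
    NullSingletonClass P := by
  rw [h.density_eq]; infer_instance

/-- Both admissible shapes of the density make the distribution function log-concave: the ratio
`F (x + d) / F x` does not increase with `x`. -/
lemma ScaleAssumptions.cdf_four_point {f : ℝ → ℝ} {γ δ : ℝ} (h : ScaleAssumptions P f γ δ)
    {u s d : ℝ} (hus : u ≤ s) (hd : 0 ≤ d) :
    P (Iic u) * P (Iic (s + d)) ≤ P (Iic (u + d)) * P (Iic s) := by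
  have := h.nullSingletonClass
  rcases h.shape with h1 | h1
  · exact cdf_four_point_of_logConcave h.density_measurable h.density_eq h1 hus hd
  · exact cdf_four_point_of_antitone h.density_eq h1 hus hd

/-! ### Spacings are non-positively correlated -/

lemma ENNReal.mul_add_mul_le {a b c d : ENNReal} (hab : a ≤ b) (hcd : c ≤ d) :
    a * d + b * c ≤ a * c + b * d := by
  obtain ⟨e, rfl⟩ := exists_add_of_le hab
  obtain ⟨g, rfl⟩ := exists_add_of_le hcd
  have : a * c + (a + e) * (c + g) = a * (c + g) + (a + e) * c + e * g := by ring
  rw [this]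
  exact le_self_add

/-- **Chebyshev's association inequality** with a weight: if `A / W` increases and `B` decreases,
then they are negatively correlated for the measure with density `W`. -/
lemma lintegral_mul_mul_lintegral_le {μ : Measure ℝ} [SFinite μ] {A B W : ℝ → ENNReal}
    (hA : Measurable A) (hB : Measurable B) (hW : Measurable W)
    (h : ∀ s t, s ≤ t → A s * W t ≤ A t * W s) (hBa : Antitone B) :
    (∫⁻ t, A t * B t ∂μ) * (∫⁻ t, W t ∂μ) ≤ (∫⁻ t, A t ∂μ) * ∫⁻ t, W t * B t ∂μ := by
  have hprod : ∀ f g : ℝ → ENNReal, Measurable f → Measurable g →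
      (∫⁻ t, f t ∂μ) * ∫⁻ t, g t ∂μ = ∫⁻ s, ∫⁻ t, f s * g t ∂μ ∂μ := by
    intro f g hf hg
    rw [← lintegral_mul_const _ hf]
    exact lintegral_congr fun s => (lintegral_const_mul _ hg).symm
  have hprod' : ∀ f g : ℝ → ENNReal, Measurable f → Measurable g →
      (∫⁻ t, f t ∂μ) * ∫⁻ t, g t ∂μ = ∫⁻ s, ∫⁻ t, g s * f t ∂μ ∂μ := by
    intro f g hf hg
    rw [mul_comm, hprod g f hg hf]
  have hAB : Measurable fun t => A t * B t := hA.mul hB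
  have hWB : Measurable fun t => W t * B t := hW.mul hB
  have hadd : ∀ f g h k : ℝ → ENNReal, Measurable f → Measurable g → Measurable h → Measurable k →
      (∫⁻ s, ∫⁻ t, f s * g t ∂μ ∂μ) + (∫⁻ s, ∫⁻ t, h s * k t ∂μ ∂μ)
        = ∫⁻ s, ∫⁻ t, f s * g t + h s * k t ∂μ ∂μ := by
    intro f g h k hf hg hh hk
    have m : Measurable fun p : ℝ × ℝ => f p.1 * g p.2 := by fun_prop
    rw [← lintegral_add_left m.lintegral_prod_right']
    exact lintegral_congr fun s => (lintegral_add_left (by fun_prop) _).symm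
  have two : 2 * ((∫⁻ t, A t * B t ∂μ) * (∫⁻ t, W t ∂μ)) ≤
      2 * ((∫⁻ t, A t ∂μ) * ∫⁻ t, W t * B t ∂μ) := by
    rw [two_mul, two_mul]
    conv_lhs => rw [hprod _ _ hAB hW]
    conv_lhs => arg 2; rw [← hprod _ _ hAB hW, hprod' _ _ hAB hW]
    conv_rhs => rw [hprod _ _ hA hWB]
    conv_rhs => arg 2; rw [← hprod _ _ hA hWB, hprod' _ _ hA hWB]
    rw [hadd _ _ _ _ hAB hW hW hAB, hadd _ _ _ _ hA hWB hWB hA]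
    refine lintegral_mono fun s => lintegral_mono fun t => ?_
    dsimp only
    rcases le_total s t with hst | hst
    · have := ENNReal.mul_add_mul_le (h s t hst) (hBa hst)
      calc A s * B s * W t + W s * (A t * B t) = A s * W t * B s + A t * W s * B t := by ring
        _ ≤ _ := this
        _ = _ := by ring
    · have := ENNReal.mul_add_mul_le (h t s hst) (hBa hst)
      calc A s * B s * W t + W s * (A t * B t) = A t * W s * B t + A s * W t * B s := by ring
        _ ≤ _ := this
        _ = _ := by ring
  exact (ENNReal.mul_le_mul_iff_right (by simp) (by simp)).1 two

lemma measurable_measure_Iic (P : Measure ℝ) : Measurable fun y => P (Iic y) :=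
  (Monotone.measurable fun _ _ h => measure_mono (Iic_subset_Iic.2 h))

lemma measurable_measure_Ioi (P : Measure ℝ) : Measurable fun y => P (Ioi y) :=
  (Antitone.measurable fun _ _ h => measure_mono (Ioi_subset_Ioi h))

lemma lintegral_spacing_eq (i : ℕ) :
    ∫⁻ x, ENNReal.ofReal (spacing i x) ∂(iidLaw P) = ∫⁻ y, P (Iic y) ^ (i + 1) * P (Ioi y) := by
  rw [lintegral_spacing]
  exact lintegral_congr fun y => measure_crossing i y

/-- Distinct spacings of the partial maxima are non-positively correlated. Given that the maximum of
the first `i + 2` observations equals `t`, the spacing `i` has a mean that is proportional to the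
integral of `F ^ (i + 1)` over `(-∞, t)` divided by `F t ^ (i + 1)`, which increases with `t` since
`F` is log-concave, and every later spacing has a mean that decreases with `t`. -/
lemma lintegral_spacing_mul_le {f : ℝ → ℝ} {γ δ : ℝ} (h : ScaleAssumptions P f γ δ) (i m : ℕ) :
    ∫⁻ x, ENNReal.ofReal (spacing i x) * ENNReal.ofReal (spacing (i + 1 + m) x) ∂(iidLaw P)
      ≤ (∫⁻ x, ENNReal.ofReal (spacing i x) ∂(iidLaw P)) *
        ∫⁻ x, ENNReal.ofReal (spacing (i + 1 + m) x) ∂(iidLaw P) := by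
  have := h.nullSingletonClass
  have mF := measurable_measure_Iic P
  have mG := measurable_measure_Ioi P
  -- The joint integrands, as functions of the position `t` of the maximum and of the level.
  set p : ℝ × ℝ → ENNReal :=
    {q : ℝ × ℝ | q.2 < q.1}.indicator (fun q => P (Iic q.2) ^ (i + 1)) with hp
  set r : ℝ × ℝ → ENNReal :=
    {q : ℝ × ℝ | q.1 ≤ q.2}.indicator (fun q => P (Iic q.2) ^ m * P (Ioi q.2)) with hr
  have hpm : Measurable p := ((mF.comp measurable_snd).pow_const (i + 1)).indicator
    (measurableSet_lt measurable_snd measurable_fst)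
  have hrm : Measurable r := (((mF.comp measurable_snd).pow_const m).mul
    (mG.comp measurable_snd)).indicator (measurableSet_le measurable_fst measurable_snd)
  have hpa : ∀ t y, p (t, y) = (Iio t).indicator (fun y => P (Iic y) ^ (i + 1)) y :=
    fun t y => rfl
  have hra : ∀ t y, r (t, y) = (Ici t).indicator (fun y => P (Iic y) ^ m * P (Ioi y)) y :=
    fun t y => rfl
  set A : ℝ → ENNReal := fun t => ∫⁻ y, p (t, y) with hA
  set B : ℝ → ENNReal := fun t => ∫⁻ z, r (t, z) with hB
  have hAm : Measurable A := hpm.lintegral_prod_right'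
  have hBm : Measurable B := hrm.lintegral_prod_right'
  have hBa : Antitone B := by
    intro s t hst
    refine lintegral_mono fun z => ?_
    rw [hra, hra]
    exact indicator_le_indicator_of_subset (Ici_subset_Ici.2 hst) (fun _ => zero_le) z
  have hAW : ∀ s t, s ≤ t → A s * P (Iic t) ^ (i + 1) ≤ A t * P (Iic s) ^ (i + 1) := by
    intro s t hst
    simp only [hA]
    rw [← lintegral_mul_const _ (by fun_prop), ← lintegral_mul_const _ (by fun_prop),
      ← lintegral_add_right_eq_self (fun y => p (t, y) * P (Iic s) ^ (i + 1)) (t - s)]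
    refine lintegral_mono fun y => ?_
    dsimp only
    rw [hpa, hpa]
    by_cases hy : y < s
    · rw [indicator_of_mem (mem_Iio.2 hy), indicator_of_mem (mem_Iio.2 (by linarith)), ← mul_pow,
        ← mul_pow]
      refine pow_le_pow_left' ?_ _
      have := h.cdf_four_point (u := y) (s := s) (d := t - s) hy.le (by linarith)
      rwa [show s + (t - s) = t by ring] at this
    · simp [indicator_of_notMem (show y ∉ Iio s from hy)]
  have key := lintegral_mul_mul_lintegral_le (μ := P) hAm hBm (mF.pow_const (i + 1)) hAW hBa
  have eA : ∫⁻ t, A t ∂P = ∫⁻ x, ENNReal.ofReal (spacing i x) ∂(iidLaw P) := by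
    rw [lintegral_spacing_eq]
    simp only [hA]
    rw [lintegral_lintegral_swap (f := fun t y => p (t, y)) hpm.aemeasurable]
    refine lintegral_congr fun y => ?_
    have : (fun t => p (t, y)) = (Ioi y).indicator fun _ => P (Iic y) ^ (i + 1) := rfl
    rw [this, lintegral_indicator_const measurableSet_Ioi]
  have eB : ∫⁻ t, P (Iic t) ^ (i + 1) * B t ∂P = ENNReal.ofReal (1 / ((i + 1 : ℕ) + 1)) *
      ∫⁻ x, ENNReal.ofReal (spacing (i + 1 + m) x) ∂(iidLaw P) := by
    have hm : Measurable fun y => P (Iic y) ^ (i + 1 + m + 1) * P (Ioi y) :=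
      (mF.pow_const _).mul mG
    rw [lintegral_spacing_eq, ← lintegral_const_mul _ hm]
    have : ∀ t, P (Iic t) ^ (i + 1) * B t = ∫⁻ z, P (Iic t) ^ (i + 1) * r (t, z) := fun t =>
      (lintegral_const_mul _ (by fun_prop)).symm
    simp_rw [this]
    rw [lintegral_lintegral_swap
      (Measurable.aemeasurable (((mF.comp measurable_fst).pow_const (i + 1)).mul hrm))]
    refine lintegral_congr fun z => ?_
    have : (fun t => P (Iic t) ^ (i + 1) * r (t, z)) = (Iic z).indicator
        fun t => P (Iic t) ^ (i + 1) * (P (Iic z) ^ m * P (Ioi z)) := by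
      ext t
      by_cases ht : t ≤ z
      · simp [hr, indicator, ht]
      · simp [hr, indicator, ht]
    rw [this, lintegral_indicator measurableSet_Iic, lintegral_mul_const _ (mF.pow_const _),
      setLIntegral_Iic_pow]
    ring
  have eAB : ∫⁻ x, ENNReal.ofReal (spacing i x) * ENNReal.ofReal (spacing (i + 1 + m) x)
      ∂(iidLaw P) ≤ ∫⁻ t, A t * B t ∂P := by
    rw [lintegral_spacing_mul, lintegral_lintegral_mul_lintegral_swap hpm hrm]
    refine lintegral_mono fun y => lintegral_mono fun z => ?_
    refine (measure_crossing_inter_le i m y z).trans (le_of_eq ?_)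
    have : (fun t => p (t, y) * r (t, z)) = (Ioc y z).indicator
        fun _ => P (Iic y) ^ (i + 1) * (P (Iic z) ^ m * P (Ioi z)) := by
      ext t
      by_cases h1 : y < t <;> by_cases h2 : t ≤ z <;> simp [hp, hr, indicator, h1, h2]
    rw [this, lintegral_indicator_const measurableSet_Ioc]
    ring
  rw [eA, eB, lintegral_cdf_pow] at key
  refine eAB.trans ?_
  refine (ENNReal.mul_le_mul_iff_left (c := ENNReal.ofReal (1 / ((i + 1 : ℕ) + 1))) ?_ (by simp)).1 ?_
  · simp; positivity
  · calc _ ≤ _ := key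
      _ = _ := by ring

/-! ### Bounds for integrals of powers and logarithms -/

lemma exists_rpow_le_exp {δ : ℝ} (hδ : 0 ≤ δ) :
    ∃ C : ℝ, 0 < C ∧ ∀ u : ℝ, 0 ≤ u → (2 * (1 + u)) ^ (2 * δ) ≤ C * Real.exp (u / 2) := by
  refine ⟨Real.exp (1 / 2 + 2 * δ * Real.log (8 * δ + 8)), Real.exp_pos _, fun u hu => ?_⟩
  have h8 : 0 < 8 * δ + 8 := by linarith
  rw [Real.rpow_def_of_pos (by linarith), ← Real.exp_add, Real.exp_le_exp]
  -- The tangent line of the logarithm at `8 * δ + 8` has a slope small enough for the factor `2 * δ`.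
  have h1 := Real.log_le_sub_one_of_pos (show 0 < 2 * (1 + u) / (8 * δ + 8) by positivity)
  rw [Real.log_div (by linarith) h8.ne'] at h1
  have h2 : 2 * δ * (2 * (1 + u) / (8 * δ + 8)) ≤ 1 / 2 + u / 2 := by
    rw [← mul_div_assoc, div_le_iff₀ h8]
    nlinarith [mul_nonneg hδ hu]
  have h3 := mul_le_mul_of_nonneg_left h1 (show 0 ≤ 2 * δ by linarith)
  nlinarith

lemma log_rpow_mul_neg_log_rpow_le {δ C : ℝ} (hδ : 0 ≤ δ)
    (hC : ∀ u : ℝ, 0 ≤ u → (2 * (1 + u)) ^ (2 * δ) ≤ C * Real.exp (u / 2)) {k s : ℝ} (hk : 2 ≤ k)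
    (hs0 : 0 < s) (hs : s ≤ 1 / 2) :
    (-Real.log s) ^ (-(2 * δ)) ≤ C * Real.exp (k * s / 2) * (Real.log k) ^ (-(2 * δ)) := by
  have hlk : 0 < Real.log k := Real.log_pos (by linarith)
  have hls : 1 / 2 ≤ -Real.log s := by
    have := Real.log_le_sub_one_of_pos hs0
    linarith
  have hks : 0 < k * s := by positivity
  have h1 : Real.log k ≤ 2 * (1 + k * s) * (-Real.log s) := by
    have h2 : Real.log k = Real.log (k * s) - Real.log s := by
      rw [Real.log_mul (by linarith) hs0.ne']; ring
    have h3 := Real.log_le_sub_one_of_pos hks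
    nlinarith
  have h4 : (Real.log k) ^ (2 * δ) ≤ (C * Real.exp (k * s / 2)) * (-Real.log s) ^ (2 * δ) := by
    calc _ ≤ (2 * (1 + k * s) * (-Real.log s)) ^ (2 * δ) :=
          Real.rpow_le_rpow hlk.le h1 (by linarith)
      _ = (2 * (1 + k * s)) ^ (2 * δ) * (-Real.log s) ^ (2 * δ) :=
          Real.mul_rpow (by positivity) (by linarith)
      _ ≤ _ := mul_le_mul_of_nonneg_right (hC _ hks.le) (Real.rpow_nonneg (by linarith) _)
  rw [Real.rpow_neg (by linarith), Real.rpow_neg hlk.le, ← div_eq_mul_inv, le_div_iff₀ (by positivity),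
    inv_mul_le_iff₀ (Real.rpow_pos_of_pos (by linarith) _)]
  linarith

lemma lintegral_rpow_mul_exp {α r : ℝ} (hα : 0 < α) (hr : 0 < r) :
    ∫⁻ s in Ioi (0 : ℝ), ENNReal.ofReal (s ^ (α - 1) * Real.exp (-(r * s)))
      = ENNReal.ofReal ((1 / r) ^ α * Real.Gamma α) := by
  have h := Real.integral_rpow_mul_exp_neg_mul_Ioi hα hr
  rw [← h, ofReal_integral_eq_lintegral_ofReal]
  · by_contra hi
    rw [integral_undef hi] at h
    have := Real.Gamma_pos_of_pos hα
    have : 0 < (1 / r) ^ α * Real.Gamma α := by positivity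
    linarith
  · exact (ae_restrict_iff' measurableSet_Ioi).2 (ae_of_all _ fun s hs =>
      mul_nonneg (Real.rpow_nonneg (le_of_lt hs) _) (Real.exp_pos _).le)

/-- A Laplace-type bound: the logarithmic factor may be evaluated at the scale `1 / k`, which is where
`(1 - s) ^ k` places the mass. -/
lemma exists_lintegral_pow_mul_rpow_mul_log_le {γ δ : ℝ} (hγ : γ < 3 / 2) (hδ : 0 ≤ δ) :
    ∃ C : ℝ, 0 < C ∧ ∀ k : ℕ, 2 ≤ k →
      ∫⁻ s in Icc (0 : ℝ) (1 / 2), ENNReal.ofReal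
        ((1 - s) ^ k * (s ^ (2 - 2 * γ) * (-Real.log s) ^ (-(2 * δ))))
      ≤ ENNReal.ofReal (C * ((k : ℝ) ^ (2 * γ - 3) * (Real.log k) ^ (-(2 * δ)))) := by
  obtain ⟨C, hC0, hC⟩ := exists_rpow_le_exp hδ
  have hG := Real.Gamma_pos_of_pos (show 0 < 3 - 2 * γ by linarith)
  refine ⟨C * (2 ^ (3 - 2 * γ) * Real.Gamma (3 - 2 * γ)), by positivity, fun k hk => ?_⟩
  have hk' : (2 : ℝ) ≤ k := by exact_mod_cast hk
  have hlk : 0 < Real.log k := Real.log_pos (by linarith)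
  have hD : 0 ≤ C * (Real.log k) ^ (-(2 * δ)) := by positivity
  rw [← restrict_Ioc_eq_restrict_Icc]
  calc _ ≤ ∫⁻ s in Ioc (0 : ℝ) (1 / 2), ENNReal.ofReal (C * (Real.log k) ^ (-(2 * δ))) *
          ENNReal.ofReal (s ^ (3 - 2 * γ - 1) * Real.exp (-(k / 2 * s))) := by
        refine setLIntegral_mono' measurableSet_Ioc fun s hs => ?_
        rw [← ENNReal.ofReal_mul hD]
        refine ENNReal.ofReal_le_ofReal ?_
        have h1 := log_rpow_mul_neg_log_rpow_le hδ hC hk' hs.1 hs.2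
        have h2 : (1 - s) ^ k ≤ Real.exp (-(k * s)) := by
          have : 1 - s ≤ Real.exp (-s) := Real.one_sub_le_exp_neg s
          calc (1 - s) ^ k ≤ (Real.exp (-s)) ^ k := by
                gcongr; linarith [hs.2]
            _ = _ := by rw [← Real.exp_nat_mul]; ring_nf
        have h0 : 0 ≤ s ^ (2 - 2 * γ) := Real.rpow_nonneg hs.1.le _
        have hl : 0 ≤ -Real.log s := by
          have := Real.log_le_sub_one_of_pos hs.1
          linarith [hs.2]
        calc (1 - s) ^ k * (s ^ (2 - 2 * γ) * (-Real.log s) ^ (-(2 * δ)))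
            ≤ Real.exp (-(k * s)) * (s ^ (2 - 2 * γ) *
                (C * Real.exp (k * s / 2) * (Real.log k) ^ (-(2 * δ)))) := by
              gcongr
          _ = C * (Real.log k) ^ (-(2 * δ)) * (s ^ (2 - 2 * γ) *
                (Real.exp (-(k * s)) * Real.exp (k * s / 2))) := by ring
          _ = _ := by
              rw [← Real.exp_add]
              ring_nf
    _ ≤ ∫⁻ s in Ioi (0 : ℝ), ENNReal.ofReal (C * (Real.log k) ^ (-(2 * δ))) *
          ENNReal.ofReal (s ^ (3 - 2 * γ - 1) * Real.exp (-(k / 2 * s))) :=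
        lintegral_mono_set fun s hs => hs.1
    _ = _ := by
        rw [lintegral_const_mul _ (by fun_prop), lintegral_rpow_mul_exp (by linarith) (by positivity),
          ← ENNReal.ofReal_mul hD]
        congr 1
        have : (1 / ((k : ℝ) / 2)) ^ (3 - 2 * γ) = 2 ^ (3 - 2 * γ) * (k : ℝ) ^ (2 * γ - 3) := by
          rw [one_div_div, Real.div_rpow (by norm_num) (by linarith), div_eq_mul_inv,
            ← Real.rpow_neg (by linarith)]
          ring_nf
        rw [this]; ring

lemma setLIntegral_rpow_mul_neg_log_le {γ δ s : ℝ} (hγ : γ < 2) (hδ : 0 ≤ δ) (hs0 : 0 < s)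
    (hs : s ≤ 1 / 2) :
    ∫⁻ t in Icc (0 : ℝ) s, ENNReal.ofReal (t ^ (1 - γ) * (-Real.log t) ^ (-δ))
      ≤ ENNReal.ofReal (s ^ (2 - γ) / (2 - γ) * (-Real.log s) ^ (-δ)) := by
  have hls : 0 < -Real.log s := by
    have := Real.log_le_sub_one_of_pos hs0
    linarith
  rw [← restrict_Ioc_eq_restrict_Icc]
  calc _ ≤ ∫⁻ t in Ioc (0 : ℝ) s, ENNReal.ofReal (t ^ (1 - γ)) *
          ENNReal.ofReal ((-Real.log s) ^ (-δ)) := by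
        refine setLIntegral_mono' measurableSet_Ioc fun t ht => ?_
        have h0 : 0 ≤ t ^ (1 - γ) := Real.rpow_nonneg ht.1.le _
        rw [← ENNReal.ofReal_mul h0]
        refine ENNReal.ofReal_le_ofReal (mul_le_mul_of_nonneg_left ?_ h0)
        refine Real.rpow_le_rpow_of_nonpos hls ?_ (by linarith)
        exact neg_le_neg (Real.log_le_log ht.1 ht.2)
    _ = _ := by
        rw [lintegral_mul_const _ (by fun_prop), ← ofReal_integral_eq_lintegral_ofReal,
          ← intervalIntegral.integral_of_le hs0.le, integral_rpow (Or.inl (by linarith)),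
          ← ENNReal.ofReal_mul]
        · congr 1
          rw [Real.zero_rpow (by linarith)]
          ring_nf
        · rw [show 1 - γ + 1 = 2 - γ by ring, Real.zero_rpow (by linarith)]
          have : 0 < 2 - γ := by linarith
          simp only [sub_zero]; positivity
        · exact (intervalIntegrable_iff_integrableOn_Ioc_of_le hs0.le).1
            (intervalIntegral.intervalIntegrable_rpow' (by linarith))
        · exact (ae_restrict_iff' measurableSet_Ioc).2
            (ae_of_all _ fun t ht => Real.rpow_nonneg ht.1.le _)

lemma exists_pow_le_rpow_mul_log {γ δ p : ℝ} (hδ : 0 ≤ δ) (hp0 : 0 < p) (hp : p < 1) :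
    ∃ C : ℝ, 0 < C ∧ ∀ k : ℕ, 2 ≤ k →
      p ^ (k - 1) ≤ C * ((k : ℝ) ^ (2 * γ - 3) * (Real.log k) ^ (-(2 * δ))) := by
  obtain ⟨N, hN⟩ := exists_nat_ge (3 - 2 * γ + 2 * δ)
  have ht := tendsto_pow_const_mul_const_pow_of_abs_lt_one N (r := p) (by rwa [abs_of_pos hp0])
  obtain ⟨C, hC⟩ := ht.bddAbove_range
  refine ⟨max C 1 / p, by positivity, fun k hk => ?_⟩
  have hk' : (2 : ℝ) ≤ k := by exact_mod_cast hk
  have hlk : 0 < Real.log k := Real.log_pos (by linarith)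
  have h1 : (k : ℝ) ^ N * p ^ k ≤ max C 1 := (hC ⟨k, rfl⟩).trans (le_max_left _ _)
  have h2 : (Real.log k) ^ (2 * δ) ≤ (k : ℝ) ^ (2 * δ) := by
    refine Real.rpow_le_rpow hlk.le ?_ (by linarith)
    linarith [Real.log_le_sub_one_of_pos (show (0 : ℝ) < k by linarith)]
  have h3 : (k : ℝ) ^ (3 - 2 * γ) * (Real.log k) ^ (2 * δ) ≤ (k : ℝ) ^ N := by
    calc _ ≤ (k : ℝ) ^ (3 - 2 * γ) * (k : ℝ) ^ (2 * δ) := by gcongr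
      _ = (k : ℝ) ^ (3 - 2 * γ + 2 * δ) := (Real.rpow_add (by linarith) _ _).symm
      _ ≤ (k : ℝ) ^ (N : ℝ) := Real.rpow_le_rpow_of_exponent_le (by linarith) hN
      _ = _ := Real.rpow_natCast _ _
  have e : p ^ k = p ^ (k - 1) * p := by rw [← pow_succ]; congr 1; omega
  have hinv : (k : ℝ) ^ (2 * γ - 3) * (Real.log k) ^ (-(2 * δ))
      = ((k : ℝ) ^ (3 - 2 * γ) * (Real.log k) ^ (2 * δ))⁻¹ := by
    rw [mul_inv, ← Real.rpow_neg (by linarith), ← Real.rpow_neg hlk.le]; ring_nf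
  have hpos : 0 < (k : ℝ) ^ (3 - 2 * γ) * (Real.log k) ^ (2 * δ) := by positivity
  rw [hinv, ← div_eq_mul_inv, le_div_iff₀ hpos, le_div_iff₀ hp0]
  calc p ^ (k - 1) * ((k : ℝ) ^ (3 - 2 * γ) * (Real.log k) ^ (2 * δ)) * p
      = ((k : ℝ) ^ (3 - 2 * γ) * (Real.log k) ^ (2 * δ)) * p ^ k := by rw [e]; ring
    _ ≤ (k : ℝ) ^ N * p ^ k := by gcongr
    _ ≤ _ := h1

/-! ### The mean of a spacing -/

lemma measure_Ioi_eq_ofReal (x : ℝ) : P (Ioi x) = ENNReal.ofReal (1 - cdf P x) := by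
  rw [← compl_Iic, prob_compl_eq_one_sub measurableSet_Iic, ← ofReal_cdf,
    ENNReal.ofReal_sub _ (cdf_nonneg P x), ENNReal.ofReal_one]

/-- A property that holds near the upper end-point holds on some `(x₀, ∞) ∩ {F < 1}`. -/
lemma exists_of_eventually_leftOfUpperEnd [NullSingletonClass P] {p : ℝ → Prop}
    (h : ∀ᶠ x in leftOfUpperEnd P, p x) :
    ∃ x₀, 1 / 2 ≤ cdf P x₀ ∧ cdf P x₀ < 1 ∧ ∀ x, x₀ < x → cdf P x < 1 → p x := by
  obtain ⟨y, hy⟩ := exists_cdf_eq (P := P) (u := 1 / 2) (by norm_num) (by norm_num)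
  obtain ⟨s, hs, hsp⟩ := mem_comap.1 h
  have key : ∀ x, cdf P x < 1 → (x : EReal) < upperEnd P := by
    intro x hx
    -- A point where `F` is still below one, by continuity, to the right of `x`.
    obtain ⟨z, hz⟩ := exists_cdf_eq (P := P) (u := (max (cdf P x) (1 / 2) + 1) / 2)
      (by positivity) (by have := max_lt hx (show (1 / 2 : ℝ) < 1 by norm_num); linarith)
    have hm := max_lt hx (show (1 / 2 : ℝ) < 1 by norm_num)
    have hz1 : cdf P z < 1 := by linarith
    have hxz : x < z := by
      by_contra hn
      have := monotone_cdf P (not_lt.1 hn)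
      linarith [le_max_left (cdf P x) (1 / 2)]
    refine lt_of_lt_of_le (EReal.coe_lt_coe_iff.2 hxz) ?_
    refine le_sInf ?_
    rintro _ ⟨w, hw, rfl⟩
    refine EReal.coe_le_coe_iff.2 ?_
    by_contra hn
    have := monotone_cdf P (not_le.1 hn).le
    have hw : cdf P w = 1 := hw
    linarith
  have hyω : (y : EReal) < upperEnd P := key y (by rw [hy]; norm_num)
  obtain ⟨a, ha, has⟩ := (mem_nhdsLT_iff_exists_Ioo_subset' hyω).1 hs
  have hm : max a y < upperEnd P := max_lt ha hyω
  obtain ⟨x₀, h1, h2⟩ := EReal.lt_iff_exists_real_btwn.1 hm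
  refine ⟨x₀, ?_, ?_, fun x hx hx1 => ?_⟩
  · rw [← hy]
    exact monotone_cdf P (EReal.coe_lt_coe_iff.1 ((le_max_right _ _).trans_lt h1)).le
  · refine (cdf_le_one P x₀).lt_of_ne fun he => ?_
    exact not_le.2 h2 (sInf_le ⟨x₀, he, rfl⟩)
  · exact hsp (has ⟨(le_max_left _ _).trans_lt (h1.trans (EReal.coe_lt_coe_iff.2 hx)), key x hx1⟩)

/-- The order of growth that the density shows at the upper end-point, as a function of the
tail probability. -/
def tailOrder (γ δ s : ℝ) : ℝ := s ^ γ * (-Real.log s) ^ δ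

lemma tailOrder_pos {γ δ s : ℝ} (h0 : 0 < s) (h1 : s < 1) : 0 < tailOrder γ δ s :=
  mul_pos (Real.rpow_pos_of_pos h0 _) (Real.rpow_pos_of_pos (by linarith [Real.log_neg h0 h1]) _)

lemma ScaleAssumptions.exists_bounds {f : ℝ → ℝ} {γ δ : ℝ} (h : ScaleAssumptions P f γ δ) :
    ∃ x₀ a b : ℝ, 1 / 2 ≤ cdf P x₀ ∧ cdf P x₀ < 1 ∧ 0 < a ∧ 0 < b ∧ ∀ x, x₀ < x → cdf P x < 1 →
      a * tailOrder γ δ (1 - cdf P x) ≤ f x ∧ f x ≤ b * tailOrder γ δ (1 - cdf P x) := by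
  have := h.nullSingletonClass
  obtain ⟨L, hL, hlim⟩ := h.limit
  obtain ⟨x₀, h1, h2, h3⟩ := exists_of_eventually_leftOfUpperEnd
    (hlim.eventually (Icc_mem_nhds (half_lt_self hL) (show L < 2 * L by linarith)))
  refine ⟨x₀, L / 2, 2 * L, h1, h2, by positivity, by positivity, fun x hx hx1 => ?_⟩
  have hF := monotone_cdf P hx.le
  have hpos : 0 < tailOrder γ δ (1 - cdf P x) := tailOrder_pos (by linarith) (by linarith)
  obtain ⟨h4, h5⟩ := h3 x hx hx1
  exact ⟨(le_div_iff₀ hpos).1 h4, (div_le_iff₀ hpos).1 h5⟩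

lemma ScaleAssumptions.delta_nonneg {P : Measure ℝ} {f : ℝ → ℝ} {γ δ : ℝ}
    (h : ScaleAssumptions P f γ δ) : 0 ≤ δ := by
  rcases h.exponents with h | h
  · exact h.1.ge
  · exact h.1.le

lemma ScaleAssumptions.gamma_lt {P : Measure ℝ} {f : ℝ → ℝ} {γ δ : ℝ}
    (h : ScaleAssumptions P f γ δ) : γ < 3 / 2 := by
  rcases h.exponents with h | h
  · exact h.2
  · linarith [h.2.2]

lemma ofReal_integral_spacing (hP : MemLp id 2 P) (i : ℕ) :
    ENNReal.ofReal (∫ x, spacing i x ∂(iidLaw P)) = ∫⁻ y, P (Iic y) ^ (i + 1) * P (Ioi y) := by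
  rw [ofReal_integral_eq_lintegral_ofReal ((memLp_spacing hP i).integrable one_le_two)
    (ae_of_all _ (spacing_nonneg i)), lintegral_spacing_eq]

lemma cdf_pow_mul_le_integral_spacing (hP : MemLp id 2 P) (i : ℕ) (a b : ℝ) :
    cdf P a ^ (i + 1) * (1 - cdf P b) * (b - a) ≤ ∫ x, spacing i x ∂(iidLaw P) := by
  have hint : 0 ≤ ∫ x, spacing i x ∂(iidLaw P) := integral_nonneg (spacing_nonneg i)
  have ha := cdf_nonneg P a
  have hb := cdf_le_one P b
  rw [← ENNReal.ofReal_le_ofReal_iff hint, ofReal_integral_spacing hP]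
  calc ENNReal.ofReal (cdf P a ^ (i + 1) * (1 - cdf P b) * (b - a))
      = ∫⁻ _ in Ioc a b, P (Iic a) ^ (i + 1) * P (Ioi b) := by
        rw [setLIntegral_const, Real.volume_Ioc, ENNReal.ofReal_mul (by
          have : 0 ≤ 1 - cdf P b := by linarith
          positivity), ENNReal.ofReal_mul (by positivity),
          ENNReal.ofReal_pow ha, ofReal_cdf, measure_Ioi_eq_ofReal]
    _ ≤ ∫⁻ y in Ioc a b, P (Iic y) ^ (i + 1) * P (Ioi y) := by
        refine setLIntegral_mono' measurableSet_Ioc fun y hy => ?_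
        refine mul_le_mul' (pow_le_pow_left' (measure_mono (Iic_subset_Iic.2 hy.1.le)) _)
          (measure_mono (Ioi_subset_Ioi hy.2))
    _ ≤ _ := setLIntegral_le_lintegral _ _

lemma integral_spacing_pos [NullSingletonClass P] (hP : MemLp id 2 P) (i : ℕ) :
    0 < ∫ x, spacing i x ∂(iidLaw P) := by
  obtain ⟨a, ha⟩ := exists_cdf_eq (P := P) (u := 1 / 3) (by norm_num) (by norm_num)
  obtain ⟨b, hb⟩ := exists_cdf_eq (P := P) (u := 2 / 3) (by norm_num) (by norm_num)
  have hab : a < b := by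
    by_contra hn
    have := monotone_cdf P (not_lt.1 hn)
    rw [ha, hb] at this; norm_num at this
  refine lt_of_lt_of_le ?_ (cdf_pow_mul_le_integral_spacing hP i a b)
  rw [ha, hb]
  have : 0 < b - a := by linarith
  positivity

/-- The order of the mean of a spacing from below: the level has to travel from the quantile of
order `1 - 1 / (2 k)` to that of order `1 - 1 / (4 k)`, where the density is of order `tailOrder`. -/
lemma ScaleAssumptions.exists_le_integral_spacing {f : ℝ → ℝ} {γ δ : ℝ}
    (h : ScaleAssumptions P f γ δ) :
    ∃ c : ℝ, 0 < c ∧ ∀ᶠ i : ℕ in atTop,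
      c * (((i + 1 : ℕ) : ℝ) ^ (γ - 2) * (Real.log (i + 1 : ℕ)) ^ (-δ))
        ≤ ∫ x, spacing i x ∂(iidLaw P) := by
  have := h.nullSingletonClass
  have hδ := h.delta_nonneg
  obtain ⟨x₀, a₀, b₀, hx0, hx1, -, hb₀, hb⟩ := h.exists_bounds
  refine ⟨1 / (32 * b₀ * (4 ^ |γ| * 3 ^ δ)), by positivity, ?_⟩
  obtain ⟨K, hK⟩ := exists_nat_gt (1 / (1 - cdf P x₀))
  filter_upwards [eventually_ge_atTop (max K 1)] with i hi
  set k : ℕ := i + 1 with hk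
  have hk2 : (2 : ℝ) ≤ k := by
    have : 2 ≤ k := by have := le_max_right K 1; omega
    exact_mod_cast this
  have hk0 : (0 : ℝ) < k := by linarith
  have hkK : 1 / (1 - cdf P x₀) < k := hK.trans_le (by
    have : K ≤ k := by have := le_max_left K 1; omega
    exact_mod_cast this)
  have hlk : 0 < Real.log k := Real.log_pos (by linarith)
  have hsmall : 1 / (2 * (k : ℝ)) < 1 - cdf P x₀ := by
    rw [div_lt_iff₀ (by linarith)] at hkK
    rw [div_lt_iff₀ (by positivity)]
    nlinarith
  have e1 : 1 / (2 * (k : ℝ)) ≤ 1 / 4 := by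
    rw [div_le_div_iff₀ (by positivity) (by norm_num)]; linarith
  have e2 : 1 / (4 * (k : ℝ)) = 1 / (2 * (k : ℝ)) / 2 := by field_simp; norm_num
  have e3 : 0 < 1 / (2 * (k : ℝ)) := by positivity
  obtain ⟨a, ha⟩ := exists_cdf_eq (P := P) (u := 1 - 1 / (2 * (k : ℝ))) (by linarith) (by linarith)
  obtain ⟨b, hbF⟩ := exists_cdf_eq (P := P) (u := 1 - 1 / (4 * (k : ℝ)))
    (by linarith) (by linarith)
  have hab : a < b := by
    by_contra hn
    have := monotone_cdf P (not_lt.1 hn)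
    rw [ha, hbF] at this; linarith
  have hxa : x₀ < a := by
    by_contra hn
    have := monotone_cdf P (not_lt.1 hn)
    rw [ha] at this; linarith
  set T : ℝ := b₀ * (4 ^ |γ| * (k : ℝ) ^ (-γ) * (3 ^ δ * (Real.log k) ^ δ)) with hT
  have hT0 : 0 < T := by positivity
  have hfT : ∀ x ∈ Ioc a b, f x ≤ T := by
    intro x hx
    have F1 := monotone_cdf P hx.1.le
    have F2 := monotone_cdf P hx.2
    rw [ha] at F1
    rw [hbF] at F2
    refine (hb x (hxa.trans hx.1) (by linarith)).2.trans (mul_le_mul_of_nonneg_left ?_ hb₀.le)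
    set s := 1 - cdf P x with hs
    have hs0 : 0 < s := by linarith
    have hsk1 : s * k ≤ 1 := by
      have : s ≤ 1 / (2 * (k : ℝ)) := by linarith
      calc s * k ≤ 1 / (2 * (k : ℝ)) * k := by gcongr
        _ = 1 / 2 := by field_simp
        _ ≤ 1 := by norm_num
    have hsk2 : 1 / 4 ≤ s * k := by
      have : 1 / (4 * (k : ℝ)) ≤ s := by linarith
      calc (1 : ℝ) / 4 = 1 / (4 * (k : ℝ)) * k := by field_simp
        _ ≤ s * k := by gcongr
    refine mul_le_mul ?_ ?_ (Real.rpow_nonneg ?_ _) (by positivity)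
    · have : s ^ γ = (s * k) ^ γ * (k : ℝ) ^ (-γ) := by
        rw [Real.mul_rpow hs0.le hk0.le, mul_assoc, ← Real.rpow_add hk0]; simp
      rw [this]
      refine mul_le_mul_of_nonneg_right ?_ (by positivity)
      calc (s * k) ^ γ ≤ (s * k) ^ (-|γ|) :=
            Real.rpow_le_rpow_of_exponent_ge (by positivity) hsk1 (neg_abs_le γ)
        _ ≤ (1 / 4 : ℝ) ^ (-|γ|) :=
            Real.rpow_le_rpow_of_nonpos (by norm_num) hsk2 (by simp)
        _ = 4 ^ |γ| := by rw [one_div, Real.inv_rpow (by norm_num), Real.rpow_neg (by norm_num), inv_inv]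
    · rw [← Real.mul_rpow (by norm_num) hlk.le]
      have hls : -Real.log s ≤ 3 * Real.log k := by
        have h4 : -Real.log s ≤ Real.log (4 * k) := by
          rw [← Real.log_inv]
          refine Real.log_le_log (by positivity) ?_
          rw [inv_le_comm₀ hs0 (by positivity)]
          rw [← one_div]; linarith
        have h5 : Real.log 4 ≤ 2 * Real.log k := by
          rw [show (4 : ℝ) = 2 ^ 2 by norm_num, Real.log_pow]
          have := Real.log_le_log (by norm_num) hk2
          push_cast; linarith
        rw [Real.log_mul (by norm_num) hk0.ne'] at h4
        linarith
      refine Real.rpow_le_rpow ?_ hls hδ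
      linarith [Real.log_neg hs0 (by linarith)]
    · linarith [Real.log_neg hs0 (by linarith)]
  have hba : 1 / (4 * (k : ℝ)) ≤ T * (b - a) := by
    rw [← ENNReal.ofReal_le_ofReal_iff (by nlinarith)]
    calc ENNReal.ofReal (1 / (4 * (k : ℝ))) = P (Ioc a b) := by
          rw [← measure_cdf P, StieltjesFunction.measure_Ioc, ha, hbF, e2]
          congr 1; ring
      _ = ∫⁻ x in Ioc a b, ENNReal.ofReal (f x) := by
          conv_lhs => rw [h.density_eq, withDensity_apply _ measurableSet_Ioc]
      _ ≤ ∫⁻ _ in Ioc a b, ENNReal.ofReal T :=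
          setLIntegral_mono' measurableSet_Ioc fun x hx => ENNReal.ofReal_le_ofReal (hfT x hx)
      _ = _ := by rw [setLIntegral_const, Real.volume_Ioc, ENNReal.ofReal_mul hT0.le]
  refine le_trans ?_ (cdf_pow_mul_le_integral_spacing h.finite_variance i a b)
  rw [ha, hbF, sub_sub_cancel]
  have hpow : 1 / 2 ≤ (1 - 1 / (2 * (k : ℝ))) ^ k := by
    have := one_add_mul_le_pow (a := -(1 / (2 * (k : ℝ)))) (by linarith) k
    calc (1 : ℝ) / 2 = 1 + k * -(1 / (2 * (k : ℝ))) := by field_simp; norm_num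
      _ ≤ _ := this
      _ = _ := by rw [← sub_eq_add_neg]
  have hba' : 1 / (4 * (k : ℝ)) / T ≤ b - a := by
    rw [div_le_iff₀ hT0]; linarith
  calc _ = 1 / 2 * (1 / (4 * (k : ℝ))) * (1 / (4 * (k : ℝ)) / T) := by
        rw [hT, Real.rpow_neg hlk.le, Real.rpow_neg hk0.le, Real.rpow_sub hk0]
        have := (Real.rpow_pos_of_pos hk0 γ).ne'
        have := (Real.rpow_pos_of_pos hlk δ).ne'
        rw [show (k : ℝ) ^ (2 : ℝ) = (k : ℝ) ^ 2 from Real.rpow_natCast _ 2]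
        field_simp
        norm_num
    _ ≤ _ := by gcongr

/-! ### The second moment of a spacing -/

/-- The integral of `F y ^ k * (1 - F z)` over `y ≤ z`. -/
def orderedTailIntegral (P : Measure ℝ) (k : ℕ) : ENNReal :=
  ∫⁻ y, P (Iic y) ^ k * ∫⁻ z in Ici y, P (Ioi z)

lemma orderedTailIntegral_le_lintegral (i : ℕ) :
    orderedTailIntegral P (i + 1) ≤
      ∫⁻ x, ENNReal.ofReal (spacing i x) * ENNReal.ofReal (spacing i x) ∂(iidLaw P) := by
  rw [lintegral_spacing_mul]
  refine lintegral_mono fun y => ?_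
  rw [← lintegral_const_mul _ (measurable_measure_Ioi P)]
  refine le_trans (le_of_eq ?_) (setLIntegral_le_lintegral (Ici y) _)
  refine setLIntegral_congr_fun measurableSet_Ici fun z hz => ?_
  rw [measure_crossing_inter_self, min_eq_left hz, max_eq_right hz]

lemma lintegral_spacing_mul_self_le (i : ℕ) :
    ∫⁻ x, ENNReal.ofReal (spacing i x) * ENNReal.ofReal (spacing i x) ∂(iidLaw P)
      ≤ 2 * orderedTailIntegral P (i + 1) := by
  have mF := measurable_measure_Iic P
  have mG := measurable_measure_Ioi P
  set p : ℝ × ℝ → ENNReal := {q : ℝ × ℝ | q.1 ≤ q.2}.indicator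
    (fun q => P (Iic q.1) ^ (i + 1) * P (Ioi q.2)) with hp
  have hpm : Measurable p := (((mF.comp measurable_fst).pow_const (i + 1)).mul
    (mG.comp measurable_snd)).indicator (measurableSet_le measurable_fst measurable_snd)
  have e : orderedTailIntegral P (i + 1) = ∫⁻ y, ∫⁻ z, p (y, z) := by
    refine lintegral_congr fun y => ?_
    rw [← lintegral_const_mul _ mG, ← lintegral_indicator measurableSet_Ici]
    rfl
  calc _ ≤ ∫⁻ y, ∫⁻ z, (p (y, z) + p (z, y)) := by
        rw [lintegral_spacing_mul]
        refine lintegral_mono fun y => lintegral_mono fun z => ?_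
        rw [measure_crossing_inter_self]
        rcases le_total y z with h | h
        · refine le_trans (le_of_eq ?_) le_self_add
          simp [hp, h]
        · refine le_trans (le_of_eq ?_) le_add_self
          simp [hp, h]
    _ = (∫⁻ y, ∫⁻ z, p (y, z)) + ∫⁻ y, ∫⁻ z, p (z, y) := by
        rw [← lintegral_add_left hpm.lintegral_prod_right']
        exact lintegral_congr fun y => lintegral_add_left (by fun_prop) _
    _ = 2 * orderedTailIntegral P (i + 1) := by
        rw [lintegral_lintegral_swap (f := fun y z => p (z, y)) (by
          exact (hpm.comp measurable_swap).aemeasurable), ← e, two_mul]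

lemma ofReal_integral_spacing_sq (hP : MemLp id 2 P) (i : ℕ) :
    ENNReal.ofReal (∫ x, spacing i x ^ 2 ∂(iidLaw P)) =
      ∫⁻ x, ENNReal.ofReal (spacing i x) * ENNReal.ofReal (spacing i x) ∂(iidLaw P) := by
  rw [ofReal_integral_eq_lintegral_ofReal (memLp_spacing hP i).integrable_sq
    (ae_of_all _ fun x => sq_nonneg _)]
  refine lintegral_congr fun x => ?_
  rw [← ENNReal.ofReal_mul (spacing_nonneg i x), sq]

lemma orderedTailIntegral_one_ne_top (hP : MemLp id 2 P) : orderedTailIntegral P 1 ≠ ⊤ := by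
  refine ne_top_of_le_ne_top ?_ (orderedTailIntegral_le_lintegral (P := P) 0)
  rw [← ofReal_integral_spacing_sq hP]
  exact ENNReal.ofReal_ne_top

/-- Integration against the density over an upper interval, in terms of the tail probability. -/
lemma setLIntegral_density_le [NullSingletonClass P] {f : ℝ → ℝ} (hf : Measurable f)
    (hP : P = volume.withDensity fun x => ENNReal.ofReal (f x)) {w : ℝ → ENNReal}
    (hw : Measurable w) {A : Set ℝ} (hA : MeasurableSet A) {s : ℝ} (hs : s ≤ 1)
    (h : ∀ x ∈ A, 1 - cdf P x ≤ s) :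
    ∫⁻ x in A, w (1 - cdf P x) * ENNReal.ofReal (f x) ≤ ∫⁻ t in Icc 0 s, w t := by
  have hm : Measurable (cdf P) := (monotone_cdf P).measurable
  have hm1 : Measurable fun x => 1 - cdf P x := by fun_prop
  have hwc : Measurable fun x => w (1 - cdf P x) := hw.comp hm1
  have e : ∫⁻ x in A, w (1 - cdf P x) * ENNReal.ofReal (f x) = ∫⁻ x in A, w (1 - cdf P x) ∂P := by
    conv_rhs => rw [show ∫⁻ x in A, w (1 - cdf P x) ∂P = ∫⁻ x in A, (fun x => w (1 - cdf P x)) x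
      ∂(volume.withDensity fun x => ENNReal.ofReal (f x)) by rw [← hP]]
    rw [setLIntegral_withDensity_eq_setLIntegral_mul _ hf.ennreal_ofReal hwc hA]
    exact lintegral_congr fun x => mul_comm _ _
  rw [e]
  calc _ ≤ ∫⁻ x in (fun x => 1 - cdf P x) ⁻¹' Iic s, w (1 - cdf P x) ∂P := lintegral_mono_set h
    _ = ∫⁻ t in Iic s, w t ∂(P.map fun x => 1 - cdf P x) :=
        (setLIntegral_map measurableSet_Iic hw hm1).symm
    _ = _ := by
        rw [map_one_sub_cdf, Measure.restrict_restrict measurableSet_Iic]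
        congr 2
        ext x; simp only [mem_inter_iff, mem_Iic, mem_Icc]
        constructor
        · rintro ⟨h1, h2, -⟩; exact ⟨h2, h1⟩
        · rintro ⟨h2, h3⟩; exact ⟨h3, h2, h3.trans hs⟩

lemma measurable_rpow_mul_neg_log_rpow {a b : ℝ} : Measurable fun t : ℝ => t ^ a * (-Real.log t) ^ b := by
  fun_prop

/-- Where the density `y` is at least `a` times the order of growth, the length element is dominated by
the density times the inverse order. -/
lemma one_le_inv_tailOrder_mul {γ δ a s y : ℝ} (ha : 0 < a) (hs0 : 0 < s) (hs1 : s < 1)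
    (h : a * tailOrder γ δ s ≤ y) :
    1 ≤ ENNReal.ofReal (a⁻¹ * (s ^ (-γ) * (-Real.log s) ^ (-δ))) * ENNReal.ofReal y := by
  have hl : 0 < -Real.log s := by linarith [Real.log_neg hs0 hs1]
  rw [← ENNReal.ofReal_mul (by positivity), ENNReal.one_le_ofReal]
  calc (1 : ℝ) = a⁻¹ * (s ^ (-γ) * (-Real.log s) ^ (-δ)) * (a * tailOrder γ δ s) := by
        rw [tailOrder, Real.rpow_neg hs0.le, Real.rpow_neg hl.le]
        have := (Real.rpow_pos_of_pos hs0 γ).ne'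
        have := (Real.rpow_pos_of_pos hl δ).ne'
        field_simp
    _ ≤ _ := by gcongr

lemma rpow_mul_log_mul {s l : ℝ} (a b c : ℝ) (hs : 0 < s) (hl : 0 < l) :
    s ^ a * l ^ b * (s ^ c * l ^ b) = s ^ (a + c) * l ^ (2 * b) := by
  rw [Real.rpow_add hs, two_mul, Real.rpow_add hl]; ring

/-- The residual mean `∫ z in [y, ∞), 1 - F z`, bounded near the upper end-point. -/
lemma lintegral_tail_le [NullSingletonClass P] {f : ℝ → ℝ} (hf : Measurable f)
    (hP : P = volume.withDensity fun x => ENNReal.ofReal (f x)) {γ δ a x₀ y : ℝ} (hγ : γ < 2)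
    (hδ : 0 ≤ δ) (ha : 0 < a) (hx0 : 1 / 2 ≤ cdf P x₀)
    (h : ∀ x, x₀ < x → cdf P x < 1 → a * tailOrder γ δ (1 - cdf P x) ≤ f x) (hy : x₀ < y) :
    ∫⁻ z in Ici y, P (Ioi z) ≤ ENNReal.ofReal (a⁻¹ * ((1 - cdf P y) ^ (2 - γ) / (2 - γ) *
      (-Real.log (1 - cdf P y)) ^ (-δ))) := by
  have hFy := monotone_cdf P hy.le
  rcases (cdf_le_one P y).eq_or_lt with h1 | h1
  · refine le_trans (le_of_eq ?_) zero_le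
    refine setLIntegral_eq_zero measurableSet_Ici fun z hz => ?_
    have := monotone_cdf P hz
    have : cdf P z = 1 := le_antisymm (cdf_le_one P z) (by linarith)
    simp [measure_Ioi_eq_ofReal, this]
  calc ∫⁻ z in Ici y, P (Ioi z)
      ≤ ∫⁻ z in Ici y, ENNReal.ofReal a⁻¹ * ENNReal.ofReal ((1 - cdf P z) ^ (1 - γ) *
          (-Real.log (1 - cdf P z)) ^ (-δ)) * ENNReal.ofReal (f z) := by
        refine setLIntegral_mono' measurableSet_Ici fun z hz => ?_
        have hz' : y ≤ z := hz
        rw [measure_Ioi_eq_ofReal]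
        rcases (cdf_le_one P z).eq_or_lt with h2 | h2
        · simp [h2]
        set s := 1 - cdf P z with hs
        have hs0 : 0 < s := by linarith
        have hs1 : s < 1 := by linarith [monotone_cdf P hz']
        have := one_le_inv_tailOrder_mul ha hs0 hs1 (h z (by linarith) h2)
        have hl : 0 < -Real.log s := by linarith [Real.log_neg hs0 hs1]
        calc ENNReal.ofReal s = ENNReal.ofReal s * 1 := (mul_one _).symm
          _ ≤ ENNReal.ofReal s * _ := mul_le_mul_right this _
          _ = _ := by
            rw [← mul_assoc]
            congr 1
            rw [← ENNReal.ofReal_mul hs0.le, ← ENNReal.ofReal_mul (by positivity)]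
            congr 1
            rw [sub_eq_add_neg, Real.rpow_add hs0, Real.rpow_one]; ring
    _ ≤ ∫⁻ t in Icc 0 (1 - cdf P y), ENNReal.ofReal a⁻¹ *
          ENNReal.ofReal (t ^ (1 - γ) * (-Real.log t) ^ (-δ)) := by
        exact setLIntegral_density_le hf hP (w := fun t => ENNReal.ofReal a⁻¹ *
          ENNReal.ofReal (t ^ (1 - γ) * (-Real.log t) ^ (-δ)))
          (measurable_rpow_mul_neg_log_rpow.ennreal_ofReal.const_mul _) measurableSet_Ici
          (by linarith [cdf_nonneg P y]) fun x hx => by linarith [monotone_cdf P hx]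
    _ ≤ _ := by
        rw [lintegral_const_mul _ measurable_rpow_mul_neg_log_rpow.ennreal_ofReal,
          ENNReal.ofReal_mul (by positivity)]
        exact mul_le_mul_right (setLIntegral_rpow_mul_neg_log_le hγ hδ (by linarith)
          (by linarith)) _

/-- The order of the second moment of a spacing from above. The part below a fixed level is
exponentially small, and the part above it is an integral over the tail probability. -/
lemma ScaleAssumptions.exists_orderedTailIntegral_le {f : ℝ → ℝ} {γ δ : ℝ}
    (h : ScaleAssumptions P f γ δ) :
    ∃ C : ℝ, 0 < C ∧ ∀ k : ℕ, 2 ≤ k → orderedTailIntegral P k ≤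
      ENNReal.ofReal (C * ((k : ℝ) ^ (2 * γ - 3) * (Real.log k) ^ (-(2 * δ)))) := by
  have := h.nullSingletonClass
  have hδ := h.delta_nonneg
  have hγ := h.gamma_lt
  obtain ⟨x₀, a, b, hx0, hx1, ha, -, hab⟩ := h.exists_bounds
  obtain ⟨C₁, hC₁, hlow⟩ := exists_pow_le_rpow_mul_log (γ := γ) hδ (p := cdf P x₀) (by linarith) hx1
  obtain ⟨C₂, hC₂, hup⟩ := exists_lintegral_pow_mul_rpow_mul_log_le hγ hδ
  set D : ℝ := a⁻¹ ^ 2 * (2 - γ)⁻¹ with hD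
  have h2γ : 0 < 2 - γ := by linarith
  have hD0 : 0 < D := by positivity
  set V := (orderedTailIntegral P 1).toReal with hV
  have hV0 : 0 ≤ V := ENNReal.toReal_nonneg
  refine ⟨C₁ * V + D * C₂, by positivity, fun k hk => ?_⟩
  have hk' : (2 : ℝ) ≤ k := by exact_mod_cast hk
  have hlk : 0 < Real.log k := Real.log_pos (by linarith)
  set R := (k : ℝ) ^ (2 * γ - 3) * (Real.log k) ^ (-(2 * δ)) with hR
  have hR0 : 0 < R := by positivity
  have part1 : ∫⁻ y in Iic x₀, P (Iic y) ^ k * ∫⁻ z in Ici y, P (Ioi z)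
      ≤ ENNReal.ofReal (C₁ * V * R) := by
    calc _ ≤ ∫⁻ y in Iic x₀, P (Iic x₀) ^ (k - 1) *
            (P (Iic y) ^ 1 * ∫⁻ z in Ici y, P (Ioi z)) := by
          refine setLIntegral_mono' measurableSet_Iic fun y hy => ?_
          rw [← mul_assoc]
          refine mul_le_mul_left ?_ _
          calc P (Iic y) ^ k = P (Iic y) ^ (k - 1) * P (Iic y) ^ 1 := by
                rw [← pow_add]; congr 1; omega
            _ ≤ _ := mul_le_mul_left (pow_le_pow_left' (measure_mono (Iic_subset_Iic.2 hy)) _) _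
      _ = P (Iic x₀) ^ (k - 1) * ∫⁻ y in Iic x₀, P (Iic y) ^ 1 * ∫⁻ z in Ici y, P (Ioi z) := by
          rw [lintegral_const_mul']
          exact ENNReal.pow_ne_top (measure_ne_top _ _)
      _ ≤ P (Iic x₀) ^ (k - 1) * orderedTailIntegral P 1 :=
          mul_le_mul_right (setLIntegral_le_lintegral _ _) _
      _ = ENNReal.ofReal (cdf P x₀ ^ (k - 1) * V) := by
          rw [ENNReal.ofReal_mul (pow_nonneg (cdf_nonneg _ _) _), ENNReal.ofReal_pow (cdf_nonneg _ _),
            ofReal_cdf, hV, ENNReal.ofReal_toReal (orderedTailIntegral_one_ne_top h.finite_variance)]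
      _ ≤ _ := by
          refine ENNReal.ofReal_le_ofReal ?_
          calc _ ≤ C₁ * R * V := by gcongr; exact hlow k hk
            _ = _ := by ring
  have part2 : ∫⁻ y in Ioi x₀, P (Iic y) ^ k * ∫⁻ z in Ici y, P (Ioi z)
      ≤ ENNReal.ofReal (D * C₂ * R) := by
    calc _ ≤ ∫⁻ y in Ioi x₀, ENNReal.ofReal D * ENNReal.ofReal ((1 - (1 - cdf P y)) ^ k *
            ((1 - cdf P y) ^ (2 - 2 * γ) * (-Real.log (1 - cdf P y)) ^ (-(2 * δ)))) *
              ENNReal.ofReal (f y) := by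
          refine setLIntegral_mono' measurableSet_Ioi fun y hy => ?_
          have hH := lintegral_tail_le h.density_measurable h.density_eq (by linarith) hδ ha hx0
            (fun x hx hx' => (hab x hx hx').1) hy
          have hFy := monotone_cdf P (le_of_lt hy)
          rw [← ofReal_cdf, ← ENNReal.ofReal_pow (cdf_nonneg _ _)]
          rcases (cdf_le_one P y).eq_or_lt with h1 | h1
          · rw [h1, sub_self, Real.zero_rpow h2γ.ne'] at hH
            have : ∫⁻ z in Ici y, P (Ioi z) = 0 := by simpa using hH
            rw [this, mul_zero]; exact zero_le
          set s := 1 - cdf P y with hs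
          have hs0 : 0 < s := by linarith
          have hs1 : s < 1 := by linarith
          have hl : 0 < -Real.log s := by linarith [Real.log_neg hs0 hs1]
          have h1s : cdf P y = 1 - s := by rw [hs]; ring
          have hone := one_le_inv_tailOrder_mul ha hs0 hs1 (hab y hy h1).1
          have hss : 0 ≤ 1 - s := by linarith
          rw [h1s]
          calc _ ≤ ENNReal.ofReal ((1 - s) ^ k) * ENNReal.ofReal (a⁻¹ * (s ^ (2 - γ) / (2 - γ) *
                (-Real.log s) ^ (-δ))) * 1 := by
                rw [mul_one]; exact mul_le_mul_right hH _
            _ ≤ ENNReal.ofReal ((1 - s) ^ k) * ENNReal.ofReal (a⁻¹ * (s ^ (2 - γ) / (2 - γ) *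
                (-Real.log s) ^ (-δ))) * _ := mul_le_mul_right hone _
            _ = _ := by
              rw [← mul_assoc]
              congr 1
              rw [← ENNReal.ofReal_mul (by positivity), ← ENNReal.ofReal_mul (by positivity),
                ← ENNReal.ofReal_mul (by positivity)]
              congr 1
              have e := rpow_mul_log_mul (2 - γ) (-δ) (-γ) hs0 hl
              rw [show 2 - γ + -γ = 2 - 2 * γ by ring, show 2 * -δ = -(2 * δ) by ring] at e
              rw [← e, hD]
              field_simp
      _ ≤ ∫⁻ t in Icc (0 : ℝ) (1 / 2), ENNReal.ofReal D * ENNReal.ofReal ((1 - t) ^ k *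
            (t ^ (2 - 2 * γ) * (-Real.log t) ^ (-(2 * δ)))) := by
          exact setLIntegral_density_le h.density_measurable h.density_eq
            (w := fun t => ENNReal.ofReal D * ENNReal.ofReal ((1 - t) ^ k *
            (t ^ (2 - 2 * γ) * (-Real.log t) ^ (-(2 * δ))))) (by fun_prop) measurableSet_Ioi
            (by norm_num) fun x hx => by linarith [monotone_cdf P (le_of_lt hx)]
      _ ≤ _ := by
          rw [lintegral_const_mul _ (by fun_prop), mul_assoc, ENNReal.ofReal_mul hD0.le]
          exact mul_le_mul_right (hup k hk) _
  rw [orderedTailIntegral, ← lintegral_add_compl _ measurableSet_Iic (A := Iic x₀), compl_Iic]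
  refine (add_le_add part1 part2).trans (le_of_eq ?_)
  rw [← ENNReal.ofReal_add (by positivity) (by positivity)]
  congr 1; ring

/-- The second moment of the spacing `i` is at most of the order of `i + 1` times its squared mean. -/
lemma ScaleAssumptions.exists_integral_spacing_sq_le {f : ℝ → ℝ} {γ δ : ℝ}
    (h : ScaleAssumptions P f γ δ) :
    ∃ C : ℝ, 0 < C ∧ ∀ i : ℕ, ∫ x, spacing i x ^ 2 ∂(iidLaw P) ≤
      C * (i + 1) * (∫ x, spacing i x ∂(iidLaw P)) ^ 2 := by
  have := h.nullSingletonClass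
  obtain ⟨c, hc, hlow⟩ := h.exists_le_integral_spacing
  obtain ⟨C, hC, hup⟩ := h.exists_orderedTailIntegral_le
  set m : ℕ → ℝ := fun i => ∫ x, spacing i x ∂(iidLaw P) with hm
  set v : ℕ → ℝ := fun i => ∫ x, spacing i x ^ 2 ∂(iidLaw P) with hv
  have hm0 : ∀ i, 0 < m i := fun i => integral_spacing_pos h.finite_variance i
  have hev : ∀ᶠ i in atTop, v i / ((i + 1) * m i ^ 2) ≤ 2 * C / c ^ 2 := by
    filter_upwards [hlow, eventually_ge_atTop 1] with i hi hi1
    set k : ℕ := i + 1 with hk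
    have hkk : (i : ℝ) + 1 = k := by rw [hk]; push_cast; ring
    have hk2 : 2 ≤ k := by omega
    have hk' : (2 : ℝ) ≤ k := by exact_mod_cast hk2
    have hlk : 0 < Real.log k := Real.log_pos (by linarith)
    set r := (k : ℝ) ^ (γ - 2) * (Real.log k) ^ (-δ) with hr
    have hr0 : 0 < r := by positivity
    have e : (k : ℝ) ^ (2 * γ - 3) * (Real.log k) ^ (-(2 * δ)) = k * r ^ 2 := by
      have hk0 : (0 : ℝ) < k := by linarith
      rw [hr, sq, rpow_mul_log_mul _ _ _ hk0 hlk, ← mul_assoc, mul_comm (k : ℝ),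
        ← Real.rpow_add_one hk0.ne']
      ring_nf
    have hvi : v i ≤ 2 * (C * (k * r ^ 2)) := by
      rw [← ENNReal.ofReal_le_ofReal_iff (by positivity), hv, ofReal_integral_spacing_sq h.finite_variance]
      refine (lintegral_spacing_mul_self_le i).trans ?_
      rw [ENNReal.ofReal_mul (by norm_num), ENNReal.ofReal_ofNat, ← e]
      exact mul_le_mul_right (hup k hk2) 2
    have hmi : (c * r) ^ 2 ≤ m i ^ 2 := by
      gcongr
    rw [hkk, div_le_div_iff₀ (mul_pos (by linarith) (pow_pos (hm0 i) 2)) (by positivity)]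
    calc v i * c ^ 2 ≤ 2 * (C * (k * r ^ 2)) * c ^ 2 := by gcongr
      _ = 2 * C * (k * (c * r) ^ 2) := by ring
      _ ≤ _ := by gcongr
  obtain ⟨N, hN⟩ := eventually_atTop.1 hev
  have hq : ∀ i, 0 ≤ v i / ((i + 1) * m i ^ 2) := fun i =>
    div_nonneg (integral_nonneg fun x => sq_nonneg _) (by positivity)
  refine ⟨2 * C / c ^ 2 + ∑ i ∈ Finset.range N, v i / ((i + 1) * m i ^ 2), ?_, fun i => ?_⟩
  · have := Finset.sum_nonneg fun i (_ : i ∈ Finset.range N) => hq i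
    positivity
  · rw [mul_assoc]
    refine (div_le_iff₀ (mul_pos (by positivity) (pow_pos (hm0 i) 2))).1 ?_
    rcases lt_or_ge i N with h1 | h1
    · have := Finset.single_le_sum (fun i _ => hq i) (Finset.mem_range.2 h1)
      have h2 : 0 ≤ 2 * C / c ^ 2 := by positivity
      exact this.trans (le_add_of_nonneg_left h2)
    · exact (hN i h1).trans (le_add_of_nonneg_right (Finset.sum_nonneg fun i _ => hq i))

/-! ### Existence and uniqueness of the best linear unbiased estimator -/

/-- A point of an affine subspace with minimal norm of the image exists and is unique, if the linear
map is injective on the direction. -/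
lemma existsUnique_norm_le_of_injOn {V E : Type*} [AddCommGroup V] [Module ℝ V]
    [FiniteDimensional ℝ V] [NormedAddCommGroup E] [InnerProductSpace ℝ E] (T : V →ₗ[ℝ] E)
    (W : Submodule ℝ V) (hW : ∀ w ∈ W, T w = 0 → w = 0) (v : V) :
    ∃! c, c - v ∈ W ∧ ∀ d, d - v ∈ W → ‖T c‖ ≤ ‖T d‖ := by
  obtain ⟨w, hw, hTw⟩ : (W.map T).starProjection (T v) ∈ W.map T :=
    Submodule.starProjection_apply_mem _ _
  have horth : ∀ u ∈ W, inner ℝ (T u) (T (v - w)) = 0 := by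
    intro u hu
    rw [map_sub, hTw]
    exact Submodule.sub_starProjection_mem_orthogonal (K := W.map T) (T v) _ ⟨u, hu, rfl⟩
  have hsplit : ∀ d, d - v ∈ W → d - (v - w) ∈ W ∧
      ‖T d‖ ^ 2 = ‖T (v - w)‖ ^ 2 + ‖T (d - (v - w))‖ ^ 2 := by
    intro d hd
    have hm : d - (v - w) ∈ W := by
      rw [show d - (v - w) = d - v + w by abel]
      exact W.add_mem hd hw
    refine ⟨hm, ?_⟩
    have h0 := horth _ hm
    rw [real_inner_comm] at h0
    have := norm_add_sq_eq_norm_sq_add_norm_sq_of_inner_eq_zero _ _ h0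
    rw [← map_add, add_sub_cancel] at this
    simpa [sq] using this
  refine ⟨v - w, ⟨by rw [sub_sub_cancel_left]; exact W.neg_mem hw, fun d hd => ?_⟩, ?_⟩
  · have := (hsplit d hd).2
    exact le_of_sq_le_sq (by nlinarith [sq_nonneg ‖T (d - (v - w))‖]) (norm_nonneg _)
  · rintro c ⟨hc, hmin⟩
    obtain ⟨hm, he⟩ := hsplit c hc
    have h1 := hmin (v - w) (by rw [sub_sub_cancel_left]; exact W.neg_mem hw)
    have h2 : ‖T c‖ ^ 2 ≤ ‖T (v - w)‖ ^ 2 := by gcongr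
    have h3 : ‖T (c - (v - w))‖ = 0 := by
      have : ‖T (c - (v - w))‖ ^ 2 ≤ 0 := by linarith
      exact pow_eq_zero_iff (two_ne_zero) |>.1 (le_antisymm this (sq_nonneg _))
    exact sub_eq_zero.1 (hW _ hm (norm_eq_zero.1 h3))

/-- On this event the partial maxima up to the index `i` coincide, with a value in `(a, b]`, and so
do those with the indices from `i + 1` to `n - 1`, with a value above `b`. -/
def singleJump (n i : ℕ) (a b : ℝ) : Set (ℕ → ℝ) :=
  Set.pi (Finset.range n) fun k => if k = 0 then Ioc a b else if k ≤ i then Iic a else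
    if k = i + 1 then Ioi b else Iic b

lemma partialSups_of_mem_singleJump {n i : ℕ} {a b : ℝ} {x : ℕ → ℝ} (hi : i + 1 < n)
    (hx : x ∈ singleJump n i a b) {j : ℕ} (hj : j < n) :
    partialSups x j = if j ≤ i then x 0 else x (i + 1) := by
  have h0 : x 0 ∈ Ioc a b := by simpa using hx 0 (by simp; omega)
  have h1 : b < x (i + 1) := by simpa using hx (i + 1) (by simpa using hi)
  have hk : ∀ k, k < n → 0 < k → (k ≤ i → x k ≤ a) ∧ (i + 1 < k → x k ≤ b) := by
    intro k hk hk0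
    have := hx k (by simpa using hk)
    constructor
    · intro h; simpa [hk0.ne', h] using this
    · intro h
      simpa [hk0.ne', show ¬ k ≤ i by omega, show ¬ k = i + 1 by omega] using this
  split_ifs with h
  · refine le_antisymm (partialSups_le_iff.2 fun k hkj => ?_) (le_partialSups_of_le x (Nat.zero_le j))
    rcases k.eq_zero_or_pos with rfl | hk0
    · exact le_rfl
    · exact ((hk k (by omega) hk0).1 (by omega)).trans h0.1.le
  · refine le_antisymm (partialSups_le_iff.2 fun k hkj => ?_) (le_partialSups_of_le x (by omega))
    rcases k.eq_zero_or_pos with rfl | hk0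
    · exact h0.2.trans h1.le
    rcases lt_trichotomy k (i + 1) with h2 | rfl | h2
    · exact (((hk k (by omega) hk0).1 (by omega)).trans (h0.1.le.trans h0.2)).trans h1.le
    · exact le_rfl
    · exact ((hk k (by omega) hk0).2 h2).trans h1.le

lemma measure_singleJump_ne_zero (n i : ℕ) {a b : ℝ} (ha : P (Iic a) ≠ 0) (hab : P (Ioc a b) ≠ 0)
    (hb : P (Ioi b) ≠ 0) : iidLaw P (singleJump n i a b) ≠ 0 := by
  have hb' : P (Iic b) ≠ 0 := fun h => hab (measure_mono_null (fun x hx => hx.2) h)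
  rw [singleJump, Measure.infinitePi_pi]
  · refine Finset.prod_ne_zero_iff.2 fun k _ => ?_
    split_ifs <;> assumption
  · intro k _
    split_ifs
    exacts [measurableSet_Ioc, measurableSet_Iic, measurableSet_Ioi, measurableSet_Iic]

/-- The partial maxima are linearly independent, as far as coefficients with sum zero are
concerned. -/
lemma eq_zero_of_maxStat_ae_eq_zero [NullSingletonClass P] {n : ℕ} {e : Fin n → ℝ}
    (hsum : ∑ i, e i = 0) (he : maxStat e =ᵐ[iidLaw P] 0) : e = 0 := by
  obtain ⟨a, ha⟩ := exists_cdf_eq (P := P) (u := 1 / 3) (by norm_num) (by norm_num)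
  obtain ⟨b, hb⟩ := exists_cdf_eq (P := P) (u := 2 / 3) (by norm_num) (by norm_num)
  have ha' : P (Iic a) ≠ 0 := by rw [← ofReal_cdf, ha]; norm_num
  have hab' : P (Ioc a b) ≠ 0 := by
    rw [← measure_cdf P, StieltjesFunction.measure_Ioc, ha, hb]; norm_num
  have hb' : P (Ioi b) ≠ 0 := by rw [measure_Ioi_eq_ofReal, hb]; norm_num
  -- All the partial sums of the coefficients vanish.
  have hpart : ∀ i : Fin n, ∑ j : Fin n, (if (j : ℕ) ≤ i then e j else 0) = 0 := by
    intro i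
    by_cases hi : (i : ℕ) + 1 < n
    · have hne := measure_singleJump_ne_zero (P := P) n i ha' hab' hb'
      obtain ⟨x, hx, hx0⟩ : ∃ x, x ∈ singleJump n i a b ∧ maxStat e x = 0 := by
        by_contra hn
        push Not at hn
        exact hne (measure_mono_null (fun x hx => hn x hx) (ae_iff.1 he))
      have h0 : x 0 ∈ Ioc a b := by simpa using hx 0 (by simp; omega)
      have h1 : b < x (i + 1) := by simpa using hx (i + 1) (by simpa using hi)
      have hval : maxStat e x =
          (x 0 - x (i + 1)) * ∑ j : Fin n, (if (j : ℕ) ≤ i then e j else 0) + x (i + 1) * ∑ j, e j := by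
        rw [maxStat, Finset.mul_sum, Finset.mul_sum, ← Finset.sum_add_distrib]
        refine Finset.sum_congr rfl fun j _ => ?_
        rw [partialSups_of_mem_singleJump hi hx j.2]
        split_ifs <;> ring
      rw [hx0, hsum, mul_zero, add_zero] at hval
      have : x 0 - x (i + 1) ≠ 0 := by have := h0.2; linarith
      exact (mul_eq_zero.1 hval.symm).resolve_left this
    · rw [← hsum]
      refine Finset.sum_congr rfl fun j _ => ?_
      rw [if_pos (by omega)]
  funext i
  obtain ⟨i, hi⟩ := i
  induction i using Nat.strong_induction_on with
  | _ i ih =>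
    have := hpart ⟨i, hi⟩
    rw [Finset.sum_eq_single ⟨i, hi⟩] at this
    · simpa using this
    · rintro ⟨j, hj⟩ - hne
      have hne : j ≠ i := fun h => hne (by simp [h])
      by_cases hji : j ≤ i
      · simpa [hji] using ih j (lt_of_le_of_ne hji hne) hj
      · simp [hji]
    · simp

/-- The linear map that takes the coefficients to the statistic, as a square integrable variable. -/
def maxStatL2 (hP : MemLp id 2 P) (n : ℕ) : (Fin n → ℝ) →ₗ[ℝ] Lp ℝ 2 (iidLaw P) where
  toFun c := (memLp_maxStat hP c).toLp
  map_add' c d := by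
    rw [← MemLp.toLp_add]
    exact MemLp.toLp_congr _ _ (ae_of_all _ fun x => maxStat_add c d x)
  map_smul' a c := by
    rw [RingHom.id_apply, ← MemLp.toLp_const_smul]
    exact MemLp.toLp_congr _ _ (ae_of_all _ fun x => maxStat_smul a c x)

lemma norm_maxStatL2_sq (hP : MemLp id 2 P) {n : ℕ} (c : Fin n → ℝ) :
    ‖maxStatL2 hP n c‖ ^ 2 = ∫ x, maxStat c x ^ 2 ∂(iidLaw P) := by
  rw [← real_inner_self_eq_norm_sq, L2.inner_def]
  refine integral_congr_ae ?_
  filter_upwards [(memLp_maxStat hP c).coeFn_toLp] with x hx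
  simp only [maxStatL2, LinearMap.coe_mk, AddHom.coe_mk, hx, real_inner_self_eq_norm_sq,
    Real.norm_eq_abs, sq_abs]

/-- The coefficients of the linear statistics that have mean zero in the whole family. -/
def nullCoefficients (hP : MemLp id 2 P) (n : ℕ) : Submodule ℝ (Fin n → ℝ) where
  carrier := {c | ∑ i, c i = 0 ∧ ∫ x, maxStat c x ∂(iidLaw P) = 0}
  zero_mem' := by simp [maxStat]
  add_mem' {c d} hc hd := by
    have hi := fun c : Fin n → ℝ => (memLp_maxStat hP c).integrable one_le_two
    refine ⟨by simp [Finset.sum_add_distrib, hc.1, hd.1], ?_⟩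
    simp only [maxStat_add]
    rw [integral_add (hi c) (hi d), hc.2, hd.2, add_zero]
  smul_mem' a c hc := by
    refine ⟨by simp [← Finset.mul_sum, hc.1], ?_⟩
    simp only [maxStat_smul]
    rw [integral_const_mul, hc.2, mul_zero]

lemma sub_mem_nullCoefficients_iff (hP : MemLp id 2 P) {n : ℕ} {c d : Fin n → ℝ}
    (hd : IsScaleUnbiased P d) : c - d ∈ nullCoefficients hP n ↔ IsScaleUnbiased P c := by
  rw [isScaleUnbiased_iff hP] at hd ⊢
  have hi := fun c : Fin n → ℝ => (memLp_maxStat hP c).integrable one_le_two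
  have h1 : ∑ i, (c - d) i = ∑ i, c i - ∑ i, d i := by simp
  have h2 : ∫ x, maxStat (c - d) x ∂(iidLaw P) =
      ∫ x, maxStat c x ∂(iidLaw P) - ∫ x, maxStat d x ∂(iidLaw P) := by
    rw [← integral_sub (hi c) (hi d)]
    refine integral_congr_ae (ae_of_all _ fun x => ?_)
    simp [maxStat, sub_mul]
  change (∑ i, (c - d) i = 0 ∧ ∫ x, maxStat (c - d) x ∂(iidLaw P) = 0) ↔ _
  rw [h1, h2, hd.1, hd.2, sub_zero, sub_eq_zero]

lemma variance_maxStat_of_unbiased (hP : MemLp id 2 P) {n : ℕ} {c : Fin n → ℝ}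
    (hc : IsScaleUnbiased P c) : Var[maxStat c; iidLaw P] = ‖maxStatL2 hP n c‖ ^ 2 - 1 := by
  rw [variance_eq_sub (memLp_maxStat hP c), ((isScaleUnbiased_iff hP c).1 hc).2,
    norm_maxStatL2_sq]
  simp

lemma ae_eq_zero_of_maxStatL2_eq_zero (hP : MemLp id 2 P) {n : ℕ} {c : Fin n → ℝ}
    (hc : maxStatL2 hP n c = 0) : maxStat c =ᵐ[iidLaw P] 0 := by
  have h1 : maxStatL2 hP n c =ᵐ[iidLaw P] maxStat c := (memLp_maxStat hP c).coeFn_toLp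
  rw [hc] at h1
  exact h1.symm.trans (Lp.coeFn_zero ℝ 2 (iidLaw P))

lemma existsUnique_isScaleBLUE [NullSingletonClass P] (hP : MemLp id 2 P) {n : ℕ}
    {v : Fin n → ℝ} (hv : IsScaleUnbiased P v) : ∃! c : Fin n → ℝ, IsScaleBLUE P c := by
  have key := existsUnique_norm_le_of_injOn (maxStatL2 hP n) (nullCoefficients hP n)
    (fun w hw hTw => eq_zero_of_maxStat_ae_eq_zero hw.1
      (ae_eq_zero_of_maxStatL2_eq_zero hP hTw)) v
  refine (existsUnique_congr fun c => ?_).1 key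
  rw [isScaleBLUE_iff, sub_mem_nullCoefficients_iff hP hv]
  refine and_congr_right fun hc => forall_congr' fun d => ?_
  rw [sub_mem_nullCoefficients_iff hP hv]
  refine forall_congr' fun hd => ?_
  rw [variance_maxStat_of_unbiased hP hc, variance_maxStat_of_unbiased hP hd, sub_le_sub_iff_right,
    sq_le_sq₀ (norm_nonneg _) (norm_nonneg _)]

/-! ### The order of the variance, and consistency -/

/-- The coefficients, in terms of the partial maxima, of the linear combination of the spacings with
the coefficients `b`. -/
def spacingCoefficients (N : ℕ) (b : ℕ → ℝ) (j : Fin (N + 1)) : ℝ :=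
  (if 1 ≤ (j : ℕ) then b (j - 1) else 0) - (if (j : ℕ) < N then b j else 0)

lemma sum_spacingCoefficients_mul (N : ℕ) (b y : ℕ → ℝ) :
    ∑ j, spacingCoefficients N b j * y j = ∑ i ∈ Finset.range N, b i * (y (i + 1) - y i) := by
  simp only [spacingCoefficients, sub_mul, Finset.sum_sub_distrib, mul_sub]
  rw [Fin.sum_univ_eq_sum_range (fun j => (if 1 ≤ j then b (j - 1) else 0) * y j) (N + 1),
    Fin.sum_univ_eq_sum_range (fun j => (if j < N then b j else 0) * y j) (N + 1),
    Finset.sum_range_succ', Finset.sum_range_succ (fun j => (if j < N then b j else 0) * y j)]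
  congr 1
  · simp
  · simp only [lt_irrefl, if_false, zero_mul, add_zero]
    exact Finset.sum_congr rfl fun j hj => by rw [if_pos (Finset.mem_range.1 hj)]

lemma maxStat_spacingCoefficients (N : ℕ) (b : ℕ → ℝ) (x : ℕ → ℝ) :
    maxStat (spacingCoefficients N b) x = ∑ i ∈ Finset.range N, b i * spacing i x :=
  sum_spacingCoefficients_mul N b _

lemma isScaleUnbiased_spacingCoefficients (hP : MemLp id 2 P) {N : ℕ} {b : ℕ → ℝ}
    (h : ∑ i ∈ Finset.range N, b i * ∫ x, spacing i x ∂(iidLaw P) = 1) :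
    IsScaleUnbiased P (spacingCoefficients N b) := by
  rw [isScaleUnbiased_iff hP]
  constructor
  · simpa using sum_spacingCoefficients_mul N b 1
  · simp only [maxStat_spacingCoefficients]
    rw [integral_finsetSum]
    · simpa only [integral_const_mul] using h
    · exact fun i _ => ((memLp_spacing hP i).integrable one_le_two).const_mul _

lemma ScaleAssumptions.covariance_spacing_nonpos {f : ℝ → ℝ} {γ δ : ℝ}
    (h : ScaleAssumptions P f γ δ) {i j : ℕ} (hij : i ≠ j) :
    cov[spacing i, spacing j; iidLaw P] ≤ 0 := by
  wlog hlt : i < j generalizing i j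
  · rw [covariance_comm]
    exact this hij.symm (lt_of_le_of_ne (not_lt.1 hlt) hij.symm)
  obtain ⟨m, rfl⟩ : ∃ m, j = i + 1 + m := ⟨j - (i + 1), by omega⟩
  have hi := memLp_spacing h.finite_variance (P := P) i
  have hj := memLp_spacing h.finite_variance (P := P) (i + 1 + m)
  have h0 : 0 ≤ ∫ x, spacing i x ∂(iidLaw P) := integral_nonneg (spacing_nonneg i)
  have h1 : 0 ≤ ∫ x, spacing (i + 1 + m) x ∂(iidLaw P) := integral_nonneg (spacing_nonneg _)
  rw [covariance_eq_sub hi hj, sub_nonpos, ← ENNReal.ofReal_le_ofReal_iff (by positivity),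
    ENNReal.ofReal_mul h0, ofReal_integral_eq_lintegral_ofReal (hi.integrable_mul hj)
    (ae_of_all _ fun x => mul_nonneg (spacing_nonneg _ _) (spacing_nonneg _ _)),
    ofReal_integral_eq_lintegral_ofReal (hi.integrable one_le_two)
    (ae_of_all _ (spacing_nonneg _)), ofReal_integral_eq_lintegral_ofReal (hj.integrable one_le_two)
    (ae_of_all _ (spacing_nonneg _))]
  simp only [Pi.mul_apply, ENNReal.ofReal_mul (spacing_nonneg i _)]
  exact lintegral_spacing_mul_le h i m

lemma ScaleAssumptions.variance_sum_spacing_le {f : ℝ → ℝ} {γ δ : ℝ}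
    (h : ScaleAssumptions P f γ δ) (N : ℕ) {b : ℕ → ℝ} (hb : ∀ i, 0 ≤ b i) :
    Var[fun x => ∑ i ∈ Finset.range N, b i * spacing i x; iidLaw P] ≤
      ∑ i ∈ Finset.range N, b i ^ 2 * ∫ x, spacing i x ^ 2 ∂(iidLaw P) := by
  have hZ := fun i => memLp_spacing h.finite_variance (P := P) i
  rw [variance_fun_sum' (X := fun i x => b i * spacing i x) fun i _ => (hZ i).const_mul (b i)]
  refine Finset.sum_le_sum fun i hi => ?_
  rw [← Finset.add_sum_erase _ _ hi]
  have h1 : cov[fun x => b i * spacing i x, fun x => b i * spacing i x; iidLaw P] ≤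
      b i ^ 2 * ∫ x, spacing i x ^ 2 ∂(iidLaw P) := by
    rw [covariance_self ((measurable_spacing i).const_mul _).aemeasurable, variance_const_mul]
    exact mul_le_mul_of_nonneg_left
      (variance_le_expectation_sq (measurable_spacing i).aestronglyMeasurable) (sq_nonneg _)
  have h2 : ∑ j ∈ (Finset.range N).erase i,
      cov[fun x => b i * spacing i x, fun x => b j * spacing j x; iidLaw P] ≤ 0 := by
    refine Finset.sum_nonpos fun j hj => ?_
    rw [covariance_const_mul_left, covariance_const_mul_right, ← mul_assoc]
    exact mul_nonpos_of_nonneg_of_nonpos (mul_nonneg (hb i) (hb j))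
      (h.covariance_spacing_nonpos (Finset.ne_of_mem_erase hj).symm)
  linarith

lemma log_le_sum_inv (N : ℕ) :
    Real.log (N + 1 : ℕ) ≤ ∑ i ∈ Finset.range N, ((i : ℝ) + 1)⁻¹ := by
  have := log_add_one_le_harmonic N
  simpa [harmonic] using this

/-- An unbiased linear statistic whose variance is at most of order `1 / log n`: with the inverse of
`(i + 1) * E (spacing i)` as the weight of the spacing `i`, up to normalization, the spacing `i`
contributes the order of `1 / (i + 1)` to the mean and to the variance. -/
lemma ScaleAssumptions.exists_unbiased_variance_le {f : ℝ → ℝ} {γ δ : ℝ}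
    (h : ScaleAssumptions P f γ δ) :
    ∃ C : ℝ, 0 < C ∧ ∀ n : ℕ, 2 ≤ n → ∃ c : Fin n → ℝ, IsScaleUnbiased P c ∧
      Var[maxStat c; iidLaw P] ≤ C / Real.log n := by
  have := h.nullSingletonClass
  obtain ⟨C, hC, hv⟩ := h.exists_integral_spacing_sq_le
  refine ⟨C, hC, fun n hn => ?_⟩
  obtain ⟨N, rfl⟩ : ∃ N, n = N + 1 := ⟨n - 1, by omega⟩
  set m : ℕ → ℝ := fun i => ∫ x, spacing i x ∂(iidLaw P) with hm
  have hm0 : ∀ i, 0 < m i := fun i => integral_spacing_pos h.finite_variance i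
  set H : ℝ := ∑ i ∈ Finset.range N, ((i : ℝ) + 1)⁻¹ with hH
  have hlog : 0 < Real.log (N + 1 : ℕ) := Real.log_pos (by exact_mod_cast hn)
  have hlH := log_le_sum_inv N
  have hH0 : 0 < H := hlog.trans_le hlH
  set b : ℕ → ℝ := fun i => ((i : ℝ) + 1)⁻¹ / (m i * H) with hb
  refine ⟨spacingCoefficients N b, isScaleUnbiased_spacingCoefficients h.finite_variance ?_, ?_⟩
  · calc ∑ i ∈ Finset.range N, b i * m i = ∑ i ∈ Finset.range N, ((i : ℝ) + 1)⁻¹ / H := by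
          refine Finset.sum_congr rfl fun i _ => ?_
          have := (hm0 i).ne'
          simp only [hb]; field_simp
      _ = 1 := by rw [← Finset.sum_div, ← hH, div_self hH0.ne']
  · have e : maxStat (spacingCoefficients N b) =
        fun x => ∑ i ∈ Finset.range N, b i * spacing i x :=
      funext (maxStat_spacingCoefficients N b)
    rw [e]
    calc _ ≤ ∑ i ∈ Finset.range N, b i ^ 2 * ∫ x, spacing i x ^ 2 ∂(iidLaw P) :=
          h.variance_sum_spacing_le N fun i => by have := hm0 i; positivity
      _ ≤ ∑ i ∈ Finset.range N, b i ^ 2 * (C * (i + 1) * m i ^ 2) := by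
          gcongr with i _; exact hv i
      _ = ∑ i ∈ Finset.range N, C / H ^ 2 * ((i : ℝ) + 1)⁻¹ := by
          refine Finset.sum_congr rfl fun i _ => ?_
          have := (hm0 i).ne'
          simp only [hb]; field_simp
      _ = C / H := by rw [← Finset.mul_sum, ← hH]; field_simp
      _ ≤ _ := by gcongr

lemma ScaleAssumptions.exists_variance_blue_le {f : ℝ → ℝ} {γ δ : ℝ}
    (h : ScaleAssumptions P f γ δ) :
    ∃ C : ℝ, ∀ n : ℕ, 2 ≤ n → ∀ c : Fin n → ℝ, IsScaleBLUE P c →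
      ∀ θ₁ θ₂ : ℝ, 0 < θ₂ →
        Var[maxStat c; sampleLaw P θ₁ θ₂] ≤ C * θ₂ ^ 2 / Real.log n := by
  obtain ⟨C, -, hC⟩ := h.exists_unbiased_variance_le
  refine ⟨C, fun n hn c hc θ₁ θ₂ hθ => ?_⟩
  obtain ⟨d, hd, hdv⟩ := hC n hn
  rw [variance_maxStat_sampleLaw c θ₁ hθ.le]
  calc _ ≤ θ₂ ^ 2 * (C / Real.log n) := by
        gcongr
        exact (((isScaleBLUE_iff c).1 hc).2 d hd).trans hdv
    _ = _ := by ring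

lemma tendstoInMeasure_of_variance_le (hP : MemLp id 2 P) {C θ₁ θ₂ : ℝ} (hθ : 0 < θ₂)
    {c : (n : ℕ) → Fin n → ℝ} (hc : ∀ n : ℕ, 2 ≤ n → IsScaleUnbiased P (c n))
    (hv : ∀ n : ℕ, 2 ≤ n → Var[maxStat (c n); sampleLaw P θ₁ θ₂] ≤ C * θ₂ ^ 2 / Real.log n) :
    TendstoInMeasure (sampleLaw P θ₁ θ₂) (fun n => maxStat (c n)) atTop (fun _ => θ₂) := by
  rw [tendstoInMeasure_iff_norm]
  intro ε hε
  have hlim : Tendsto (fun n : ℕ => ENNReal.ofReal (C * θ₂ ^ 2 / Real.log n / ε ^ 2)) atTop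
      (𝓝 0) := by
    rw [← ENNReal.ofReal_zero]
    refine ENNReal.tendsto_ofReal ?_
    have h1 : Tendsto (fun n : ℕ => C * θ₂ ^ 2 / Real.log n) atTop (𝓝 0) :=
      (Real.tendsto_log_atTop.comp tendsto_natCast_atTop_atTop).const_div_atTop _
    simpa using h1.div_const (ε ^ 2)
  refine tendsto_of_tendsto_of_tendsto_of_le_of_le' tendsto_const_nhds hlim
    (Eventually.of_forall fun _ => zero_le) ?_
  filter_upwards [eventually_ge_atTop 2] with n hn
  have := meas_ge_le_variance_div_sq (memLp_maxStat_sampleLaw hP (c n) θ₁ hθ.le) hε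
  rw [(hc n hn θ₁ θ₂ hθ).2] at this
  refine this.trans (ENNReal.ofReal_le_ofReal ?_)
  gcongr
  exact hv n hn

theorem ScaleAssumptions.blue {f : ℝ → ℝ} {γ δ : ℝ} (h : ScaleAssumptions P f γ δ) :
    (∀ n : ℕ, 2 ≤ n → ∃! c : Fin n → ℝ, IsScaleBLUE P c) ∧
    (∃ C : ℝ, ∀ n : ℕ, 2 ≤ n → ∀ c : Fin n → ℝ, IsScaleBLUE P c →
      ∀ θ₁ θ₂ : ℝ, 0 < θ₂ →
        Var[maxStat c; sampleLaw P θ₁ θ₂] ≤ C * θ₂ ^ 2 / Real.log n) ∧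
    (∀ c : (n : ℕ) → Fin n → ℝ, (∀ n : ℕ, 2 ≤ n → IsScaleBLUE P (c n)) →
      ∀ θ₁ θ₂ : ℝ, 0 < θ₂ →
        TendstoInMeasure (sampleLaw P θ₁ θ₂) (fun n => maxStat (c n)) atTop
          (fun _ => θ₂)) := by
  have := h.nullSingletonClass
  obtain ⟨C, hC⟩ := h.exists_variance_blue_le
  refine ⟨fun n hn => ?_, ⟨C, hC⟩, fun c hc θ₁ θ₂ hθ => ?_⟩
  · obtain ⟨D, -, hD⟩ := h.exists_unbiased_variance_le
    obtain ⟨v, hv, -⟩ := hD n hn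
    exact existsUnique_isScaleBLUE h.finite_variance hv
  · exact tendstoInMeasure_of_variance_le h.finite_variance hθ (fun n hn => (hc n hn).1)
      fun n hn => hC n hn (c n) (hc n hn) θ₁ θ₂ hθ

/-! ### Distributions given by a distribution function -/

/-- A continuous distribution function that is differentiable off a countable set has its derivative
as a density. -/
lemma isProbabilityMeasure_withDensity_and_cdf {F f : ℝ → ℝ} (hc : Continuous F) (hm : Monotone F)
    (h0 : Tendsto F atBot (𝓝 0)) (h1 : Tendsto F atTop (𝓝 1)) (hf0 : ∀ x, 0 ≤ f x)
    {S : Set ℝ} (hS : S.Countable) (hd : ∀ x ∉ S, HasDerivAt F (f x) x) :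
    IsProbabilityMeasure (volume.withDensity fun x => ENNReal.ofReal (f x)) ∧
      ∀ x, cdf (volume.withDensity fun x => ENNReal.ofReal (f x)) x = F x := by
  let G : StieltjesFunction ℝ := ⟨F, hm, fun x => hc.continuousWithinAt⟩
  have e : G.measure = volume.withDensity fun x => ENNReal.ofReal (f x) := by
    refine Measure.ext_of_Ioc _ _ fun {a b} hab => ?_
    have hi : IntervalIntegrable f volume a b := by
      refine (hm.monotoneOn (uIcc a b)).intervalIntegrable_deriv.congr_ae ?_
      refine ae_restrict_of_ae ?_
      filter_upwards [compl_mem_ae_iff.2 (hS.measure_zero volume)] with x hx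
      exact (hd x hx).deriv
    have hI := integral_eq_of_hasDerivAt_off_countable_of_le F f hab.le hS hc.continuousOn
      (fun x hx => hd x hx.2) hi
    rw [StieltjesFunction.measure_Ioc, withDensity_apply _ measurableSet_Ioc,
      ← ofReal_integral_eq_lintegral_ofReal
        ((intervalIntegrable_iff_integrableOn_Ioc_of_le hab.le).1 hi) (ae_of_all _ hf0),
      ← intervalIntegral.integral_of_le hab.le, hI]
  rw [← e]
  have hp : IsProbabilityMeasure G.measure := G.isProbabilityMeasure h0 h1
  exact ⟨hp, fun x => by rw [cdf_measure_stieltjesFunction G h0 h1]⟩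

lemma memLp_id_two_withDensity {f : ℝ → ℝ} (hf : Measurable f) (hf0 : ∀ x, 0 ≤ f x)
    (hi : Integrable fun x => x ^ 2 * f x) :
    MemLp id 2 (volume.withDensity fun x => ENNReal.ofReal (f x)) := by
  rw [memLp_two_iff_integrable_sq measurable_id.aestronglyMeasurable,
    integrable_withDensity_iff hf.ennreal_ofReal (by simp)]
  simpa only [id, ENNReal.toReal_ofReal (hf0 _)] using hi

lemma integrable_sq_mul_of_le_exp {f : ℝ → ℝ} (hf : Measurable f) (hf0 : ∀ x, 0 ≤ f x) {C : ℝ}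
    (h : ∀ x, f x ≤ C * Real.exp (-|x|)) : Integrable fun x => x ^ 2 * f x := by
  refine Integrable.mono' (integrable_inv_one_add_sq.const_mul (26 * C)) (by fun_prop)
    (ae_of_all _ fun x => ?_)
  rw [Real.norm_eq_abs, abs_of_nonneg (mul_nonneg (sq_nonneg x) (hf0 x))]
  have hC : 0 ≤ C := by
    have := (hf0 0).trans (h 0)
    simpa using this
  have h2 := Real.pow_div_factorial_le_exp |x| (abs_nonneg x) 2
  have h4 := Real.pow_div_factorial_le_exp |x| (abs_nonneg x) 4
  have e2 : |x| ^ 2 = x ^ 2 := sq_abs x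
  have e4 : |x| ^ 4 = x ^ 4 := by rw [show 4 = 2 * 2 from rfl, pow_mul, pow_mul, sq_abs]
  rw [e2] at h2
  rw [e4] at h4
  norm_num [Nat.factorial] at h2 h4
  have hx : x ^ 2 * (1 + x ^ 2) ≤ 26 * Real.exp |x| := by nlinarith
  rw [← div_eq_mul_inv, le_div_iff₀ (by positivity)]
  calc x ^ 2 * f x * (1 + x ^ 2) = f x * (x ^ 2 * (1 + x ^ 2)) := by ring
    _ ≤ C * Real.exp (-|x|) * (26 * Real.exp |x|) :=
        mul_le_mul (h x) hx (by positivity) (by positivity)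
    _ = 26 * C * (Real.exp (-|x|) * Real.exp |x|) := by ring
    _ = 26 * C := by rw [← Real.exp_add]; simp

lemma leftOfUpperEnd_le_atTop {P : Measure ℝ} (h : ∀ x, cdf P x < 1) :
    leftOfUpperEnd P ≤ atTop := by
  have : upperEnd P = ⊤ := by
    have e : {x : ℝ | cdf P x = 1} = ∅ := by
      ext x; simpa using (h x).ne
    rw [upperEnd, e, image_empty, sInf_empty]
  rw [leftOfUpperEnd, this]
  have h2 : 𝓝[<] (⊤ : EReal) ≤ map (fun x : ℝ => (x : EReal)) atTop := by
    rw [← EReal.nhdsWithin_top]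
    exact nhdsWithin_mono _ fun x hx => ne_of_lt hx
  exact (comap_mono h2).trans (comap_map EReal.coe_injective).le

lemma leftOfUpperEnd_le_nhdsLT {P : Measure ℝ} {w : ℝ} (h : ∀ x, cdf P x = 1 ↔ w ≤ x) :
    leftOfUpperEnd P ≤ 𝓝[<] w := by
  have : upperEnd P = (w : EReal) := by
    have e : {x : ℝ | cdf P x = 1} = Ici w := by
      ext x; simp [h]
    rw [upperEnd, e]
    refine IsGLB.sInf_eq (IsLeast.isGLB ⟨⟨w, self_mem_Ici, rfl⟩, ?_⟩)
    rintro _ ⟨x, hx, rfl⟩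
    exact EReal.coe_le_coe_iff.2 hx
  rw [leftOfUpperEnd, this, nhdsWithin, nhdsWithin, comap_inf, comap_principal,
    ← EReal.isEmbedding_coe.isInducing.nhds_eq_comap]
  refine inf_le_inf_left _ (principal_mono.2 fun x hx => ?_)
  exact EReal.coe_lt_coe_iff.1 hx

/-- The filter `l` consists of the left neighbourhoods of the upper end-point of the distribution
function `F`, where `F` either stays below one or equals one exactly from some point on. -/
def IsUpperEndFilter (F : ℝ → ℝ) (l : Filter ℝ) : Prop :=
  ((∀ x, F x < 1) ∧ l = atTop) ∨ ∃ w, (∀ x, F x = 1 ↔ w ≤ x) ∧ l = 𝓝[<] w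

lemma isCovered_of_measure {F f : ℝ → ℝ} {γ δ L : ℝ} {P : Measure ℝ} [IsProbabilityMeasure P]
    (hF : ∀ x, cdf P x = F x) (hfm : Measurable f) (hf0 : ∀ x, 0 ≤ f x)
    (hP : P = volume.withDensity fun x => ENNReal.ofReal (f x)) (h2 : MemLp id 2 P)
    (hshape : LogConcaveOn {x | 0 < F x ∧ F x < 1} f ∨ AntitoneOn f {x | 0 < F x ∧ F x < 1})
    (hexp : (δ = 0 ∧ γ < 3 / 2) ∨ (0 < δ ∧ 1 / 2 < γ ∧ γ ≤ 1)) (hL : 0 < L) {l : Filter ℝ}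
    (hl : IsUpperEndFilter F l)
    (hlim : Tendsto (fun x => f x / ((1 - F x) ^ γ * (-Real.log (1 - F x)) ^ δ)) l (𝓝 L)) :
    IsCovered F γ δ := by
  have hJ : cdfSupport P = {x | 0 < F x ∧ F x < 1} := by
    simp only [cdfSupport, hF]
  refine ⟨P, f, inferInstance, hF, ⟨h2, hfm, hf0, hP, hJ ▸ hshape, hexp, L, hL, ?_⟩⟩
  simp only [hF]
  refine hlim.mono_left ?_
  rcases hl with ⟨h, rfl⟩ | ⟨w, h, rfl⟩
  · exact leftOfUpperEnd_le_atTop fun x => by rw [hF]; exact h x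
  · exact leftOfUpperEnd_le_nhdsLT fun x => by rw [hF]; exact h x

lemma isCovered_of_hasDerivAt {F f : ℝ → ℝ} {γ δ L : ℝ} (hc : Continuous F) (hm : Monotone F)
    (h0 : Tendsto F atBot (𝓝 0)) (h1 : Tendsto F atTop (𝓝 1)) (hfm : Measurable f)
    (hf0 : ∀ x, 0 ≤ f x) {S : Set ℝ} (hS : S.Countable) (hd : ∀ x ∉ S, HasDerivAt F (f x) x)
    (h2 : Integrable fun x => x ^ 2 * f x)
    (hshape : LogConcaveOn {x | 0 < F x ∧ F x < 1} f ∨ AntitoneOn f {x | 0 < F x ∧ F x < 1})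
    (hexp : (δ = 0 ∧ γ < 3 / 2) ∨ (0 < δ ∧ 1 / 2 < γ ∧ γ ≤ 1)) (hL : 0 < L) {l : Filter ℝ}
    (hl : IsUpperEndFilter F l)
    (hlim : Tendsto (fun x => f x / ((1 - F x) ^ γ * (-Real.log (1 - F x)) ^ δ)) l (𝓝 L)) :
    IsCovered F γ δ := by
  obtain ⟨hp, hF⟩ := isProbabilityMeasure_withDensity_and_cdf hc hm h0 h1 hf0 hS hd
  exact isCovered_of_measure hF hfm hf0 rfl (memLp_id_two_withDensity hfm hf0 h2) hshape hexp hL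
    hl hlim

/-! ### Examples: elementary distribution functions -/

lemma logConcaveOn_of_log_eq {s : Set ℝ} {f g : ℝ → ℝ} (hpos : ∀ x ∈ s, 0 < f x)
    (hg : ConcaveOn ℝ s g) (h : ∀ x ∈ s, Real.log (f x) = g x) : LogConcaveOn s f :=
  ⟨hpos, hg.congr fun x hx => (h x hx).symm⟩

lemma isCovered_powerCdf {l : ℝ} (hl : 0 < l) : IsCovered (powerCdf l) 0 0 := by
  have hF : powerCdf l = fun x => (max 0 (min x 1)) ^ l := by
    funext x
    unfold powerCdf
    split_ifs with h1 h2
    · rw [min_eq_left (by linarith), max_eq_left h1, Real.zero_rpow hl.ne']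
    · rw [min_eq_left h2.le, max_eq_right (by linarith)]
    · rw [min_eq_right (by linarith), max_eq_right zero_le_one, Real.one_rpow]
  have hJ : {x | 0 < powerCdf l x ∧ powerCdf l x < 1} = Ioo 0 1 := by
    ext x
    simp only [mem_ofPred_eq, mem_Ioo, powerCdf]
    split_ifs with h1 h2
    · simp [h1]
    · have h0 : 0 < x := by linarith
      simp [h0, h2, Real.rpow_pos_of_pos h0, Real.rpow_lt_one h0.le h2 hl]
    · simp [h2]
  have hval : ∀ x ∈ Ioo (0 : ℝ) 1, (Ioo (0 : ℝ) 1).indicator (fun x => l * x ^ (l - 1)) x =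
      l * x ^ (l - 1) := fun x hx => indicator_of_mem hx _
  refine isCovered_of_hasDerivAt (f := (Ioo (0 : ℝ) 1).indicator fun x => l * x ^ (l - 1))
    (S := {0, 1}) (L := l) (l := 𝓝[<] 1) ?_ ?_ ?_ ?_ ?_ ?_ ?_ ?_ ?_ ?_ (Or.inl ⟨rfl, by norm_num⟩)
    hl (Or.inr ⟨1, fun x => ?_, rfl⟩) ?_
  · rw [hF]
    exact (continuous_const.max (continuous_id.min continuous_const)).rpow_const
      fun x => Or.inr hl.le
  · rw [hF]
    intro x y hxy
    exact Real.rpow_le_rpow (le_max_left _ _) (max_le_max le_rfl (min_le_min hxy le_rfl)) hl.le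
  · refine tendsto_const_nhds.congr' ?_
    filter_upwards [eventually_le_atBot 0] with x hx
    simp [powerCdf, hx]
  · refine tendsto_const_nhds.congr' ?_
    filter_upwards [eventually_ge_atTop 1] with x hx
    simp [powerCdf, show ¬ x ≤ 0 by linarith, show ¬ x < 1 by linarith]
  · exact Measurable.indicator (by fun_prop) measurableSet_Ioo
  · exact fun x => indicator_nonneg (fun x hx => mul_nonneg hl.le (Real.rpow_nonneg hx.1.le _)) x
  · exact (Set.toFinite _).countable
  · intro x hx
    simp only [mem_insert_iff, mem_singleton_iff, not_or] at hx
    rcases lt_or_gt_of_ne hx.1 with h0 | h0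
    · rw [indicator_of_notMem (by simp [h0.le])]
      refine (hasDerivAt_const x 0).congr_of_eventuallyEq ?_
      filter_upwards [Iio_mem_nhds h0] with y hy
      simp [powerCdf, (mem_Iio.1 hy).le]
    rcases lt_or_gt_of_ne hx.2 with h1 | h1
    · rw [hval x ⟨h0, h1⟩]
      refine (Real.hasDerivAt_rpow_const (Or.inl h0.ne')).congr_of_eventuallyEq ?_
      filter_upwards [Ioo_mem_nhds h0 h1] with y hy
      simp [powerCdf, not_le.2 hy.1, hy.2]
    · rw [indicator_of_notMem (by simp [h1.le])]
      refine (hasDerivAt_const x 1).congr_of_eventuallyEq ?_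
      filter_upwards [Ioi_mem_nhds h1] with y hy
      have hy : 1 < y := hy
      simp [powerCdf, show ¬ y ≤ 0 by linarith, show ¬ y < 1 by linarith]
  · have e : (fun x : ℝ => x ^ 2 * (Ioo (0 : ℝ) 1).indicator (fun x => l * x ^ (l - 1)) x)
        = (Ioo (0 : ℝ) 1).indicator fun x => x ^ 2 * (l * x ^ (l - 1)) := by
      ext x; simp only [indicator]; split_ifs <;> simp
    rw [e, integrable_indicator_iff measurableSet_Ioo]
    have h1 : IntegrableOn (fun x : ℝ => l * x ^ (l - 1)) (Ioo 0 1) :=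
      ((intervalIntegrable_iff_integrableOn_Ioo_of_le zero_le_one).1
        (intervalIntegral.intervalIntegrable_rpow' (by linarith))).const_mul l
    refine h1.mono' (by fun_prop) ((ae_restrict_iff' measurableSet_Ioo).2
      (ae_of_all _ fun x hx => ?_))
    have h3 : 0 ≤ l * x ^ (l - 1) := mul_nonneg hl.le (Real.rpow_nonneg hx.1.le _)
    rw [Real.norm_eq_abs, abs_of_nonneg (by positivity)]
    exact mul_le_of_le_one_left h3 (pow_le_one₀ hx.1.le hx.2.le)
  · rw [hJ]
    rcases le_total 1 l with h1 | h1
    · left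
      refine logConcaveOn_of_log_eq (g := fun x => Real.log l + (l - 1) * Real.log x)
        (fun x hx => ?_) ?_ fun x hx => ?_
      · rw [hval x hx]; exact mul_pos hl (Real.rpow_pos_of_pos hx.1 _)
      · have := strictConcaveOn_log_Ioi.concaveOn.subset
          (fun x hx => hx.1 : Ioo (0 : ℝ) 1 ⊆ Ioi 0) (convex_Ioo 0 1)
        exact (concaveOn_const _ (convex_Ioo 0 1)).add (this.smul (by linarith))
      · rw [hval x hx, Real.log_mul hl.ne' (Real.rpow_pos_of_pos hx.1 _).ne', Real.log_rpow hx.1]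
    · right
      intro x hx y hy hxy
      rw [hval x hx, hval y hy]
      exact mul_le_mul_of_nonneg_left
        (Real.rpow_le_rpow_of_nonpos hx.1 hxy (by linarith)) hl.le
  · simp only [powerCdf]
    split_ifs with h1 h2
    · simp; linarith
    · have := Real.rpow_lt_one (by linarith) h2 hl
      simp [this.ne, h2]
    · simpa using h2
  · have h1 : Tendsto (fun x : ℝ => l * x ^ (l - 1)) (𝓝[<] 1) (𝓝 l) := by
      have : ContinuousAt (fun x : ℝ => l * x ^ (l - 1)) 1 :=
        (Real.continuousAt_rpow_const 1 (l - 1) (Or.inl one_ne_zero)).const_mul l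
      simpa using this.tendsto.mono_left nhdsWithin_le_nhds
    refine h1.congr' ?_
    filter_upwards [Ioo_mem_nhdsLT zero_lt_one] with x hx
    rw [hval x hx]; simp

lemma isCovered_logisticCdf : IsCovered logisticCdf 1 0 := by
  have hpos : ∀ x : ℝ, 0 < 1 + Real.exp (-x) := fun x => by positivity
  have hFpos : ∀ x, 0 < logisticCdf x := fun x => by unfold logisticCdf; positivity
  have hFlt : ∀ x, logisticCdf x < 1 := fun x => by
    unfold logisticCdf
    rw [div_lt_one (hpos x)]
    linarith [Real.exp_pos (-x)]
  have hJ : {x | 0 < logisticCdf x ∧ logisticCdf x < 1} = univ := by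
    ext x; simp [hFpos, hFlt]
  have hmono : Monotone logisticCdf := by
    intro x y hxy
    unfold logisticCdf
    gcongr
  have hdexp : ∀ x : ℝ, HasDerivAt (fun x => 1 + Real.exp (-x)) (-Real.exp (-x)) x := fun x => by
    simpa using ((hasDerivAt_neg x).exp).const_add 1
  have hlim0 : Tendsto logisticCdf atBot (𝓝 0) := by
    have h1 : Tendsto (fun x : ℝ => 1 + Real.exp (-x)) atBot atTop :=
      tendsto_atTop_add_const_left _ _ (Real.tendsto_exp_atTop.comp tendsto_neg_atBot_atTop)
    exact h1.const_div_atTop 1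
  have hlim1 : Tendsto logisticCdf atTop (𝓝 1) := by
    have h1 : Tendsto (fun x : ℝ => 1 + Real.exp (-x)) atTop (𝓝 (1 + 0)) :=
      tendsto_const_nhds.add (Real.tendsto_exp_atBot.comp tendsto_neg_atTop_atBot)
    have h2 := (tendsto_const_nhds (x := (1 : ℝ))).div h1 (by norm_num)
    rw [add_zero, div_one] at h2
    exact h2
  refine isCovered_of_hasDerivAt
    (f := fun x => Real.exp (-x) / (1 + Real.exp (-x)) ^ 2) (S := ∅) (L := 1) (l := atTop)
    ?_ hmono hlim0 hlim1 (by fun_prop) (fun x => by positivity) countable_empty ?_ ?_ ?_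
    (Or.inl ⟨rfl, by norm_num⟩) one_pos (Or.inl ⟨hFlt, rfl⟩) ?_
  · exact continuous_const.div (by fun_prop) fun x => (hpos x).ne'
  · intro x _
    have := (hasDerivAt_const x (1 : ℝ)).div (hdexp x) (hpos x).ne'
    exact this.congr_deriv (by ring)
  · refine integrable_sq_mul_of_le_exp (C := 1) (by fun_prop) (fun x => by positivity) fun x => ?_
    rw [one_mul, div_le_iff₀ (by positivity)]
    have he := Real.exp_pos (-x)
    rcases le_total 0 x with hx | hx
    · rw [abs_of_nonneg hx]
      nlinarith [sq_nonneg (Real.exp (-x))]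
    · rw [abs_of_nonpos hx, neg_neg]
      have : Real.exp x * Real.exp (-x) = 1 := by rw [← Real.exp_add]; simp
      have h0 := Real.exp_pos x
      calc Real.exp (-x) = Real.exp x * Real.exp (-x) * Real.exp (-x) := by rw [this, one_mul]
        _ ≤ Real.exp x * Real.exp (-x) * Real.exp (-x) + Real.exp x * (1 + 2 * Real.exp (-x)) :=
          le_add_of_nonneg_right (by positivity)
        _ = _ := by ring
  · left
    rw [hJ]
    refine logConcaveOn_of_log_eq (g := fun x => -x - 2 * Real.log (1 + Real.exp (-x)))
      (fun x _ => by positivity) ?_ fun x _ => ?_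
    · have hd : ∀ x, HasDerivAt (fun x => -x - 2 * Real.log (1 + Real.exp (-x)))
          (1 - 2 * logisticCdf x) x := by
        intro x
        have := (hasDerivAt_neg x).sub (((hdexp x).log (hpos x).ne').const_mul 2)
        refine this.congr_deriv ?_
        have := (hpos x).ne'
        unfold logisticCdf
        field_simp
        ring
      refine Antitone.concaveOn_univ_of_deriv (fun x => (hd x).differentiableAt) ?_
      rw [funext fun x => (hd x).deriv]
      intro x y hxy
      have := hmono hxy
      dsimp only
      linarith
    · rw [Real.log_div (Real.exp_pos _).ne' (by positivity), Real.log_exp, Real.log_pow]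
      norm_num
  · refine hlim1.congr fun x => ?_
    have := (hpos x).ne'
    have h2 := (Real.exp_pos (-x)).ne'
    have e : 1 - logisticCdf x = Real.exp (-x) / (1 + Real.exp (-x)) := by
      unfold logisticCdf; field_simp; ring
    rw [Real.rpow_zero, mul_one, Real.rpow_one, e]
    unfold logisticCdf
    field_simp

lemma isCovered_paretoCdf {a : ℝ} (ha : 2 < a) : IsCovered (paretoCdf a) (1 + 1 / a) 0 := by
  have ha0 : 0 < a := by linarith
  have hF : paretoCdf a = fun x => 1 - (max x 1) ^ (-a) := by
    funext x
    unfold paretoCdf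
    split_ifs with h1
    · rw [max_eq_right h1, Real.one_rpow, sub_self]
    · rw [max_eq_left (by linarith)]
  have hlt : ∀ x, paretoCdf a x < 1 := fun x => by
    rw [hF]
    have : 0 < (max x 1) ^ (-a) := Real.rpow_pos_of_pos (by positivity) _
    simpa using this
  have hJ : {x | 0 < paretoCdf a x ∧ paretoCdf a x < 1} = Ioi 1 := by
    ext x
    simp only [mem_ofPred_eq, hlt, and_true, mem_Ioi]
    unfold paretoCdf
    split_ifs with h1
    · simpa using h1
    · have := Real.rpow_lt_one_of_one_lt_of_neg (not_le.1 h1) (show -a < 0 by linarith)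
      simp [this, not_le.1 h1]
  have hval : ∀ x ∈ Ioi (1 : ℝ), (Ioi (1 : ℝ)).indicator (fun x => a * x ^ (-a - 1)) x =
      a * x ^ (-a - 1) := fun x hx => indicator_of_mem hx _
  refine isCovered_of_hasDerivAt (f := (Ioi (1 : ℝ)).indicator fun x => a * x ^ (-a - 1))
    (S := {1}) (L := a) (l := atTop) ?_ ?_ ?_ ?_ ?_ ?_ (countable_singleton 1) ?_ ?_ ?_
    (Or.inl ⟨rfl, ?_⟩) ha0 (Or.inl ⟨hlt, rfl⟩) ?_
  · rw [hF]
    exact continuous_const.sub ((continuous_id.max continuous_const).rpow_const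
      fun x => Or.inl (by positivity))
  · rw [hF]
    intro x y hxy
    exact sub_le_sub_left (Real.rpow_le_rpow_of_nonpos (by positivity) (max_le_max hxy le_rfl)
      (by linarith)) 1
  · refine tendsto_const_nhds.congr' ?_
    filter_upwards [eventually_le_atBot 1] with x hx
    simp [paretoCdf, hx]
  · have h1 : Tendsto (fun x : ℝ => 1 - x ^ (-a)) atTop (𝓝 (1 - 0)) :=
      tendsto_const_nhds.sub (tendsto_rpow_neg_atTop ha0)
    rw [sub_zero] at h1
    refine h1.congr' ?_
    filter_upwards [eventually_gt_atTop 1] with x hx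
    simp [paretoCdf, hx]
  · exact Measurable.indicator (by fun_prop) measurableSet_Ioi
  · exact fun x => indicator_nonneg (fun x hx => mul_nonneg ha0.le
      (Real.rpow_nonneg (zero_le_one.trans (le_of_lt hx)) _)) x
  · intro x hx
    rcases lt_or_gt_of_ne (show x ≠ 1 from hx) with h1 | h1
    · rw [indicator_of_notMem (by simp [h1.le])]
      refine (hasDerivAt_const x 0).congr_of_eventuallyEq ?_
      filter_upwards [Iio_mem_nhds h1] with y hy
      simp [paretoCdf, (mem_Iio.1 hy).le]
    · rw [hval x h1]
      have := (Real.hasDerivAt_rpow_const (x := x) (p := -a)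
        (Or.inl (by linarith))).const_sub 1
      refine (this.congr_deriv (by ring)).congr_of_eventuallyEq ?_
      filter_upwards [Ioi_mem_nhds h1] with y hy
      simp [paretoCdf, mem_Ioi.1 hy]
  · have e : (fun x : ℝ => x ^ 2 * (Ioi (1 : ℝ)).indicator (fun x => a * x ^ (-a - 1)) x)
        = (Ioi (1 : ℝ)).indicator fun x => x ^ 2 * (a * x ^ (-a - 1)) := by
      ext x; simp only [indicator]; split_ifs <;> simp
    rw [e, integrable_indicator_iff measurableSet_Ioi]
    have h1 : IntegrableOn (fun x : ℝ => a * x ^ (1 - a)) (Ioi 1) :=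
      (integrableOn_Ioi_rpow_of_lt (show 1 - a < -1 by linarith) one_pos).const_mul a
    refine h1.congr_fun (fun x hx => ?_) measurableSet_Ioi
    have hx0 : 0 < x := zero_lt_one.trans hx
    dsimp only
    rw [← Real.rpow_natCast x 2, mul_left_comm, ← Real.rpow_add hx0]
    congr 2; push_cast; ring
  · right
    rw [hJ]
    intro x hx y hy hxy
    rw [hval x hx, hval y hy]
    exact mul_le_mul_of_nonneg_left (Real.rpow_le_rpow_of_nonpos (zero_lt_one.trans hx) hxy
      (by linarith)) ha0.le
  · have : 1 / a < 1 / 2 := one_div_lt_one_div_of_lt two_pos ha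
    linarith
  · refine tendsto_const_nhds.congr' ?_
    filter_upwards [eventually_gt_atTop 1] with x hx
    have hx0 : 0 < x := by linarith
    have e : 1 - paretoCdf a x = x ^ (-a) := by simp [paretoCdf, not_le.2 hx]
    have e2 : -a * (1 + 1 / a) = -a - 1 := by field_simp; ring
    rw [hval x hx, e, Real.rpow_zero, mul_one, ← Real.rpow_mul hx0.le, e2,
      mul_div_cancel_right₀ _ (Real.rpow_pos_of_pos hx0 _).ne']

lemma isCovered_negExpCdf : IsCovered negExpCdf 0 0 := by
  have hF : negExpCdf = fun x => Real.exp (min x 0) := by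
    funext x
    unfold negExpCdf
    split_ifs with h1
    · rw [min_eq_left h1.le]
    · rw [min_eq_right (by linarith), Real.exp_zero]
  have hpos : ∀ x, 0 < negExpCdf x := fun x => by rw [hF]; positivity
  have hone : ∀ x, negExpCdf x = 1 ↔ 0 ≤ x := fun x => by
    rw [hF]; simp
  have hJ : {x | 0 < negExpCdf x ∧ negExpCdf x < 1} = Iio 0 := by
    ext x
    simp only [mem_ofPred_eq, hpos, true_and, mem_Iio]
    rw [hF]; simp
  have hval : ∀ x ∈ Iio (0 : ℝ), (Iio (0 : ℝ)).indicator Real.exp x = Real.exp x :=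
    fun x hx => indicator_of_mem hx _
  refine isCovered_of_hasDerivAt (f := (Iio (0 : ℝ)).indicator Real.exp)
    (S := {0}) (L := 1) (l := 𝓝[<] 0) ?_ ?_ ?_ ?_ ?_ ?_ (countable_singleton 0) ?_ ?_ ?_
    (Or.inl ⟨rfl, by norm_num⟩) one_pos (Or.inr ⟨0, hone, rfl⟩) ?_
  · rw [hF]; fun_prop
  · rw [hF]
    exact fun x y hxy => Real.exp_le_exp.2 (min_le_min hxy le_rfl)
  · refine Real.tendsto_exp_atBot.congr' ?_
    filter_upwards [eventually_lt_atBot 0] with x hx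
    simp [negExpCdf, hx]
  · refine tendsto_const_nhds.congr' ?_
    filter_upwards [eventually_ge_atTop 0] with x hx
    exact ((hone x).2 hx).symm
  · exact Real.measurable_exp.indicator measurableSet_Iio
  · exact fun x => indicator_nonneg (fun x _ => (Real.exp_pos x).le) x
  · intro x hx
    rcases lt_or_gt_of_ne (show x ≠ 0 from hx) with h1 | h1
    · rw [hval x h1]
      refine (Real.hasDerivAt_exp x).congr_of_eventuallyEq ?_
      filter_upwards [Iio_mem_nhds h1] with y hy
      simp [negExpCdf, mem_Iio.1 hy]
    · rw [indicator_of_notMem (by simp [h1.le])]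
      refine (hasDerivAt_const x 1).congr_of_eventuallyEq ?_
      filter_upwards [Ioi_mem_nhds h1] with y hy
      exact (hone y).2 (le_of_lt hy)
  · refine integrable_sq_mul_of_le_exp (C := 1) (Real.measurable_exp.indicator measurableSet_Iio)
      (fun x => indicator_nonneg (fun x _ => (Real.exp_pos x).le) x) fun x => ?_
    by_cases hx : x < 0
    · rw [hval x hx, abs_of_neg hx, neg_neg, one_mul]
    · rw [indicator_of_notMem (show x ∉ Iio 0 from hx)]; positivity
  · left
    rw [hJ]
    refine logConcaveOn_of_log_eq (g := fun x => x) (fun x hx => ?_) (concaveOn_id (convex_Iio 0))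
      fun x hx => ?_
    · rw [hval x hx]; exact Real.exp_pos x
    · rw [hval x hx, Real.log_exp]
  · have h1 : Tendsto Real.exp (𝓝[<] 0) (𝓝 1) := by
      simpa using (Real.continuous_exp.tendsto 0).mono_left nhdsWithin_le_nhds
    refine h1.congr' ?_
    filter_upwards [self_mem_nhdsWithin] with x hx
    rw [hval x hx]; simp

lemma isCovered_weibullCdf {c : ℝ} (hc : 1 ≤ c) : IsCovered (weibullCdf c) 1 (1 - 1 / c) := by
  have hc0 : 0 < c := by linarith
  have hF : weibullCdf c = fun x => 1 - Real.exp (-(max x 0) ^ c) := by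
    funext x
    unfold weibullCdf
    split_ifs with h1
    · rw [max_eq_right h1, Real.zero_rpow hc0.ne']; simp
    · rw [max_eq_left (by linarith)]
  have hlt : ∀ x, weibullCdf c x < 1 := fun x => by
    rw [hF]
    linarith [Real.exp_pos (-(max x 0) ^ c)]
  have hJ : {x | 0 < weibullCdf c x ∧ weibullCdf c x < 1} = Ioi 0 := by
    ext x
    simp only [mem_ofPred_eq, hlt, and_true, mem_Ioi]
    unfold weibullCdf
    split_ifs with h1
    · simpa using h1
    · have := Real.rpow_pos_of_pos (not_le.1 h1) c
      simp [this, not_le.1 h1]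
  have hval : ∀ x ∈ Ioi (0 : ℝ), (Ioi (0 : ℝ)).indicator
      (fun x => c * x ^ (c - 1) * Real.exp (-x ^ c)) x = c * x ^ (c - 1) * Real.exp (-x ^ c) :=
    fun x hx => indicator_of_mem hx _
  refine isCovered_of_hasDerivAt
    (f := (Ioi (0 : ℝ)).indicator fun x => c * x ^ (c - 1) * Real.exp (-x ^ c))
    (S := {0}) (L := c) (l := atTop) ?_ ?_ ?_ ?_ ?_ ?_ (countable_singleton 0) ?_ ?_ ?_
    ?_ hc0 (Or.inl ⟨hlt, rfl⟩) ?_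
  · rw [hF]
    have : Continuous fun x : ℝ => (max x 0) ^ c :=
      (continuous_id.max continuous_const).rpow_const fun x => Or.inr hc0.le
    fun_prop
  · rw [hF]
    intro x y hxy
    have := Real.rpow_le_rpow (le_max_right x 0) (max_le_max hxy le_rfl) hc0.le
    exact sub_le_sub_left (Real.exp_le_exp.2 (neg_le_neg this)) 1
  · refine tendsto_const_nhds.congr' ?_
    filter_upwards [eventually_le_atBot 0] with x hx
    simp [weibullCdf, hx]
  · have h1 : Tendsto (fun x : ℝ => 1 - Real.exp (-x ^ c)) atTop (𝓝 (1 - 0)) :=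
      tendsto_const_nhds.sub (Real.tendsto_exp_atBot.comp
        (tendsto_neg_atTop_atBot.comp (tendsto_rpow_atTop hc0)))
    rw [sub_zero] at h1
    refine h1.congr' ?_
    filter_upwards [eventually_gt_atTop 0] with x hx
    simp [weibullCdf, hx]
  · exact Measurable.indicator (by fun_prop) measurableSet_Ioi
  · exact fun x => indicator_nonneg (fun x hx => mul_nonneg (mul_nonneg hc0.le
      (Real.rpow_nonneg (le_of_lt hx) _)) (Real.exp_pos _).le) x
  · intro x hx
    rcases lt_or_gt_of_ne (show x ≠ 0 from hx) with h1 | h1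
    · rw [indicator_of_notMem (by simp [h1.le])]
      refine (hasDerivAt_const x 0).congr_of_eventuallyEq ?_
      filter_upwards [Iio_mem_nhds h1] with y hy
      simp [weibullCdf, (mem_Iio.1 hy).le]
    · rw [hval x h1]
      have := ((Real.hasDerivAt_rpow_const (x := x) (p := c) (Or.inl h1.ne')).neg.exp).const_sub 1
      refine (this.congr_deriv (by simp; ring)).congr_of_eventuallyEq ?_
      filter_upwards [Ioi_mem_nhds h1] with y hy
      simp [weibullCdf, mem_Ioi.1 hy]
  · have e : (fun x : ℝ => x ^ 2 * (Ioi (0 : ℝ)).indicator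
        (fun x => c * x ^ (c - 1) * Real.exp (-x ^ c)) x)
        = (Ioi (0 : ℝ)).indicator fun x => x ^ 2 * (c * x ^ (c - 1) * Real.exp (-x ^ c)) := by
      ext x; simp only [indicator]; split_ifs <;> simp
    rw [e, integrable_indicator_iff measurableSet_Ioi]
    have h1 : IntegrableOn (fun x : ℝ => c * (x ^ (c + 1) * Real.exp (-x ^ c))) (Ioi 0) :=
      (integrableOn_rpow_mul_exp_neg_rpow (show -1 < c + 1 by linarith) hc0).const_mul c
    refine h1.congr_fun (fun x hx => ?_) measurableSet_Ioi
    have hx0 : 0 < x := hx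
    have e2 : x ^ (c + 1) = x ^ 2 * x ^ (c - 1) := by
      rw [← Real.rpow_natCast x 2, ← Real.rpow_add hx0]
      congr 1; push_cast; ring
    dsimp only
    rw [e2]; ring
  · left
    rw [hJ]
    refine logConcaveOn_of_log_eq (g := fun x => Real.log c + (c - 1) * Real.log x - x ^ c)
      (fun x hx => ?_) ?_ fun x hx => ?_
    · rw [hval x hx]
      have := Real.rpow_pos_of_pos (show 0 < x from hx) (c - 1)
      positivity
    · have h1 : ConcaveOn ℝ (Ioi (0 : ℝ)) fun x => (c - 1) * Real.log x :=
        strictConcaveOn_log_Ioi.concaveOn.smul (by linarith)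
      exact ((concaveOn_const _ (convex_Ioi 0)).add h1).sub
        ((convexOn_rpow hc).subset Ioi_subset_Ici_self (convex_Ioi 0))
    · have h1 := Real.rpow_pos_of_pos (show 0 < x from hx) (c - 1)
      rw [hval x hx, Real.log_mul (by positivity) (Real.exp_pos _).ne', Real.log_exp,
        Real.log_mul hc0.ne' h1.ne', Real.log_rpow hx]
      ring
  · rcases hc.eq_or_lt with rfl | h1
    · left; norm_num
    · right
      have : 1 / c < 1 := (div_lt_one hc0).2 h1
      exact ⟨by linarith, by norm_num, le_rfl⟩
  · refine tendsto_const_nhds.congr' ?_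
    filter_upwards [eventually_gt_atTop 0] with x hx
    have e : 1 - weibullCdf c x = Real.exp (-x ^ c) := by simp [weibullCdf, not_le.2 hx]
    have e2 : c * (1 - 1 / c) = c - 1 := by field_simp
    rw [hval x hx, e, Real.rpow_one, Real.log_exp, neg_neg, ← Real.rpow_mul hx.le, e2]
    have h1 := (Real.rpow_pos_of_pos hx (c - 1)).ne'
    have h2 := (Real.exp_pos (-x ^ c)).ne'
    field_simp

lemma isCovered_gumbelCdf : IsCovered gumbelCdf 1 0 := by
  have hpos : ∀ x, 0 < gumbelCdf x := fun x => Real.exp_pos _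
  have hlt : ∀ x, gumbelCdf x < 1 := fun x => by
    rw [gumbelCdf, Real.exp_lt_one_iff]
    simpa using Real.exp_pos (-x)
  have hJ : {x | 0 < gumbelCdf x ∧ gumbelCdf x < 1} = univ := by
    ext x; simp [hpos, hlt]
  have hexp : Tendsto (fun x : ℝ => Real.exp (-x)) atTop (𝓝 0) :=
    Real.tendsto_exp_atBot.comp tendsto_neg_atTop_atBot
  have hlim1 : Tendsto gumbelCdf atTop (𝓝 1) := by
    have := (Real.continuous_exp.tendsto 0).comp (by simpa using hexp.neg :
      Tendsto (fun x : ℝ => -Real.exp (-x)) atTop (𝓝 0))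
    rw [Real.exp_zero] at this
    exact this
  refine isCovered_of_hasDerivAt
    (f := fun x => Real.exp (-x) * gumbelCdf x) (S := ∅) (L := 1) (l := atTop)
    (by unfold gumbelCdf; fun_prop) ?_ ?_ hlim1 (by unfold gumbelCdf; fun_prop)
    (fun x => by have := hpos x; positivity) countable_empty ?_ ?_ ?_
    (Or.inl ⟨rfl, by norm_num⟩) one_pos (Or.inl ⟨hlt, rfl⟩) ?_
  · intro x y hxy
    exact Real.exp_le_exp.2 (neg_le_neg (Real.exp_le_exp.2 (neg_le_neg hxy)))
  · exact Real.tendsto_exp_atBot.comp (tendsto_neg_atTop_atBot.comp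
      (Real.tendsto_exp_atTop.comp tendsto_neg_atBot_atTop))
  · intro x _
    refine ((hasDerivAt_neg x).exp.neg.exp).congr_deriv ?_
    simp [gumbelCdf]; ring
  · refine integrable_sq_mul_of_le_exp (C := 2) (by unfold gumbelCdf; fun_prop)
      (fun x => by have := hpos x; positivity) fun x => ?_
    rcases le_total 0 x with hx | hx
    · rw [abs_of_nonneg hx]
      have := (hlt x).le
      have := Real.exp_pos (-x)
      nlinarith
    · rw [abs_of_nonpos hx, neg_neg, gumbelCdf]
      -- With `u = exp (-x)`, the bound `u ^ 2 * exp (-u) ≤ 2`.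
      set u := Real.exp (-x) with hu
      have hu0 : 0 < u := Real.exp_pos _
      have h2 := Real.pow_div_factorial_le_exp u hu0.le 2
      norm_num [Nat.factorial] at h2
      have hx' : Real.exp x = u⁻¹ := by rw [hu, ← Real.exp_neg, neg_neg]
      rw [hx', Real.exp_neg, ← div_eq_mul_inv, ← div_eq_mul_inv, div_le_div_iff₀ (Real.exp_pos _) hu0]
      nlinarith
  · left
    rw [hJ]
    refine logConcaveOn_of_log_eq (g := fun x => -x - Real.exp (-x))
      (fun x _ => by have := hpos x; positivity) ?_ fun x _ => ?_
    · have h1 : ConvexOn ℝ univ fun x : ℝ => Real.exp (-x) := by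
        exact convexOn_exp.comp_linearMap (-LinearMap.id : ℝ →ₗ[ℝ] ℝ)
      exact (convexOn_id convex_univ).neg.sub h1
    · rw [Real.log_mul (Real.exp_pos _).ne' (hpos x).ne', Real.log_exp, gumbelCdf, Real.log_exp]
      ring
  · -- With `u = exp (-x)`, the ratio is `u / (exp u - 1)`.
    have h1 : Tendsto (fun u : ℝ => u⁻¹ * (Real.exp u - 1)) (𝓝[≠] 0) (𝓝 1) := by
      have := (hasDerivAt_iff_tendsto_slope_zero).1 (Real.hasDerivAt_exp 0)
      simpa using this
    have h2 : Tendsto (fun x : ℝ => Real.exp (-x)) atTop (𝓝[≠] 0) :=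
      tendsto_nhdsWithin_iff.2 ⟨hexp, Eventually.of_forall fun x => (Real.exp_pos _).ne'⟩
    have h3 := (h1.comp h2).inv₀ one_ne_zero
    rw [inv_one] at h3
    refine h3.congr fun x => ?_
    set u := Real.exp (-x) with hu
    have hu0 : 0 < u := Real.exp_pos _
    have hne : Real.exp u - 1 ≠ 0 := by
      have := Real.add_one_lt_exp hu0.ne'
      linarith
    have e : gumbelCdf x = (Real.exp u)⁻¹ := by rw [gumbelCdf, Real.exp_neg]
    have hE := (Real.exp_pos u).ne'
    rw [Real.rpow_one, Real.rpow_zero, mul_one, e]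
    simp only [Function.comp]
    rw [← hu]
    have e2 : 1 - (Real.exp u)⁻¹ = (Real.exp u - 1) / Real.exp u := by field_simp
    rw [e2]
    field_simp

/-! ### The normal distribution -/

lemma gaussianPDFReal_zero_one (x : ℝ) :
    gaussianPDFReal 0 1 x = (√(2 * Real.pi))⁻¹ * Real.exp (-x ^ 2 / 2) := by
  simp [gaussianPDFReal]

lemma hasDerivAt_gaussianPDFReal_zero_one (x : ℝ) :
    HasDerivAt (gaussianPDFReal 0 1) (-x * gaussianPDFReal 0 1 x) x := by
  have h := (((hasDerivAt_pow 2 x).neg.div_const 2).exp).const_mul (√(2 * Real.pi))⁻¹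
  rw [funext gaussianPDFReal_zero_one]
  refine h.congr_deriv ?_
  simp; ring

lemma normalCdf_eq_integral (x : ℝ) : normalCdf x = ∫ t in Iic x, gaussianPDFReal 0 1 t := by
  rw [normalCdf, cdf_eq_real, measureReal_def, gaussianReal_apply_eq_integral _ one_ne_zero,
    ENNReal.toReal_ofReal (integral_nonneg fun t => gaussianPDFReal_nonneg _ _ _)]

lemma hasDerivAt_normalCdf (x : ℝ) : HasDerivAt normalCdf (gaussianPDFReal 0 1 x) x := by
  have hi := integrable_gaussianPDFReal 0 1
  have hc : Continuous (gaussianPDFReal 0 1) :=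
    continuous_iff_continuousAt.2 fun x => (hasDerivAt_gaussianPDFReal_zero_one x).continuousAt
  have e : normalCdf = fun x => normalCdf 0 + ∫ t in (0 : ℝ)..x, gaussianPDFReal 0 1 t := by
    funext y
    rw [normalCdf_eq_integral, normalCdf_eq_integral,
      ← intervalIntegral.integral_Iic_sub_Iic hi.integrableOn hi.integrableOn]
    ring
  rw [e]
  exact (hc.integral_hasStrictDerivAt 0 x).hasDerivAt.const_add _

/-- **Mills' ratio**: the tail of the standard normal law is equivalent to the density divided by
the argument. -/
lemma tendsto_normal_tail_div :
    Tendsto (fun x => (1 - normalCdf x) / (gaussianPDFReal 0 1 x / x)) atTop (𝓝 1) := by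
  have hφ : Tendsto (gaussianPDFReal 0 1) atTop (𝓝 0) := by
    have h1 : Tendsto (fun x : ℝ => -x ^ 2 / 2) atTop atBot := by
      have := (tendsto_pow_atTop (α := ℝ) two_ne_zero).atTop_div_const two_pos
      exact (tendsto_neg_atTop_atBot.comp this).congr fun x => (neg_div 2 (x ^ 2)).symm
    have := (Real.tendsto_exp_atBot.comp h1).const_mul (√(2 * Real.pi))⁻¹
    rw [mul_zero] at this
    exact this.congr fun x => (gaussianPDFReal_zero_one x).symm
  have hpos : ∀ x, 0 < gaussianPDFReal 0 1 x := fun x => gaussianPDFReal_pos _ _ _ one_ne_zero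
  refine HasDerivAt.lhopital_zero_atTop (f' := fun x => -gaussianPDFReal 0 1 x)
    (g' := fun x => (-x * gaussianPDFReal 0 1 x * x - gaussianPDFReal 0 1 x * 1) / x ^ 2)
    (Eventually.of_forall fun x => (hasDerivAt_normalCdf x).const_sub 1) ?_ ?_ ?_ ?_ ?_
  · filter_upwards [eventually_gt_atTop 0] with x hx
    exact (hasDerivAt_gaussianPDFReal_zero_one x).div (hasDerivAt_id x) hx.ne'
  · filter_upwards [eventually_gt_atTop 0] with x hx
    refine div_ne_zero ?_ (by positivity)
    have := mul_pos (hpos x) (show 0 < x ^ 2 + 1 by positivity)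
    nlinarith
  · have := (tendsto_cdf_atTop (gaussianReal 0 1)).const_sub 1
    rw [sub_self] at this
    exact this
  · exact hφ.div_atTop tendsto_id
  · have h1 : Tendsto (fun x : ℝ => (1 + (x ^ 2)⁻¹)⁻¹) atTop (𝓝 (1 + 0)⁻¹) :=
      ((tendsto_inv_atTop_zero.comp (tendsto_pow_atTop (α := ℝ) two_ne_zero)).const_add 1).inv₀
        (by norm_num)
    rw [add_zero, inv_one] at h1
    refine h1.congr' ?_
    filter_upwards [eventually_gt_atTop 0] with x hx
    have h2 := (hpos x).ne'
    have h3 : -x * gaussianPDFReal 0 1 x * x - gaussianPDFReal 0 1 x * 1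
        = -(gaussianPDFReal 0 1 x * (x ^ 2 + 1)) := by ring
    rw [h3]
    field_simp

lemma normalCdf_lt_one (x : ℝ) : normalCdf x < 1 := by
  have hs : StrictMono normalCdf := strictMono_of_deriv_pos fun x => by
    rw [(hasDerivAt_normalCdf x).deriv]; exact gaussianPDFReal_pos _ _ _ one_ne_zero
  exact (hs (lt_add_one x)).trans_le (cdf_le_one _ _)

lemma normalCdf_pos (x : ℝ) : 0 < normalCdf x := by
  have hs : StrictMono normalCdf := strictMono_of_deriv_pos fun x => by
    rw [(hasDerivAt_normalCdf x).deriv]; exact gaussianPDFReal_pos _ _ _ one_ne_zero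
  exact (cdf_nonneg _ _).trans_lt (hs (sub_one_lt x))

lemma tendsto_neg_log_normal_tail_div :
    Tendsto (fun x => -Real.log (1 - normalCdf x) / x ^ 2) atTop (𝓝 (1 / 2)) := by
  have hr := tendsto_normal_tail_div
  have hinv : Tendsto (fun x : ℝ => (x ^ 2)⁻¹) atTop (𝓝 0) :=
    tendsto_inv_atTop_zero.comp (tendsto_pow_atTop (α := ℝ) two_ne_zero)
  have h1 : Tendsto (fun x : ℝ => Real.log (√(2 * Real.pi)) * (x ^ 2)⁻¹) atTop (𝓝 0) := by
    simpa using hinv.const_mul (Real.log (√(2 * Real.pi)))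
  have h2 : Tendsto (fun x : ℝ => Real.log x / x * x⁻¹) atTop (𝓝 0) := by
    simpa using Real.isLittleO_log_id_atTop.tendsto_div_nhds_zero.mul tendsto_inv_atTop_zero
  have h3 : Tendsto (fun x => Real.log ((1 - normalCdf x) / (gaussianPDFReal 0 1 x / x)) *
      (x ^ 2)⁻¹) atTop (𝓝 0) := by
    simpa using (hr.log one_ne_zero).mul hinv
  have h := ((h1.const_add (1 / 2)).add h2).sub h3
  simp only [add_zero, sub_zero] at h
  refine h.congr' ?_
  filter_upwards [eventually_gt_atTop 0] with x hx
  have hG : 0 < 1 - normalCdf x := by linarith [normalCdf_lt_one x]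
  have hφ := gaussianPDFReal_pos 0 1 x one_ne_zero
  have hs : 0 < √(2 * Real.pi) := by positivity
  rw [Real.log_div hG.ne' (by positivity), Real.log_div hφ.ne' hx.ne', gaussianPDFReal_zero_one,
    Real.log_mul (by positivity) (Real.exp_pos _).ne', Real.log_inv, Real.log_exp]
  field_simp
  ring

lemma isCovered_normalCdf : IsCovered normalCdf 1 (1 / 2) := by
  have hJ : {x | 0 < normalCdf x ∧ normalCdf x < 1} = univ := by
    ext x; simp [normalCdf_pos, normalCdf_lt_one]
  have hpos : ∀ x, 0 < gaussianPDFReal 0 1 x := fun x => gaussianPDFReal_pos _ _ _ one_ne_zero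
  refine isCovered_of_measure (P := gaussianReal 0 1) (f := gaussianPDFReal 0 1)
    (L := (1 * (1 / 2 : ℝ) ^ (1 / 2 : ℝ))⁻¹) (l := atTop) (fun x => rfl)
    (measurable_gaussianPDFReal 0 1) (gaussianPDFReal_nonneg 0 1)
    (gaussianReal_of_var_ne_zero 0 one_ne_zero) (memLp_id_gaussianReal' 2 (by simp)) ?_
    (Or.inr ⟨by norm_num, by norm_num, le_rfl⟩) (by positivity) (Or.inl ⟨normalCdf_lt_one, rfl⟩) ?_
  · left
    rw [hJ]
    refine logConcaveOn_of_log_eq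
      (g := fun x => Real.log (√(2 * Real.pi))⁻¹ - (1 / 2) * x ^ 2) (fun x _ => hpos x) ?_
      fun x _ => ?_
    · have h1 : ConvexOn ℝ univ fun x : ℝ => (1 / 2 : ℝ) * x ^ 2 :=
        (Even.convexOn_pow (by norm_num)).smul (by norm_num)
      exact (concaveOn_const _ convex_univ).sub h1
    · rw [gaussianPDFReal_zero_one, Real.log_mul (by positivity) (Real.exp_pos _).ne', Real.log_exp]
      ring
  · have h := (tendsto_normal_tail_div.mul (tendsto_neg_log_normal_tail_div.rpow_const
      (p := 1 / 2) (Or.inl (by norm_num)))).inv₀ (by positivity)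
    refine h.congr' ?_
    filter_upwards [eventually_gt_atTop 0] with x hx
    have hG : 0 < 1 - normalCdf x := by linarith [normalCdf_lt_one x]
    have hl : 0 ≤ -Real.log (1 - normalCdf x) := by
      have := Real.log_nonpos hG.le (by linarith [normalCdf_pos x])
      linarith
    have hx2 : (x ^ 2) ^ (1 / 2 : ℝ) = x := by
      rw [← Real.sqrt_eq_rpow, Real.sqrt_sq hx.le]
    have hφ := (hpos x).ne'
    rw [Real.div_rpow hl (by positivity), hx2, Real.rpow_one, mul_inv, inv_div, inv_div]
    field_simp

end

theorem corollary6p1 :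
    (∀ (P : Measure ℝ) [IsProbabilityMeasure P] (f : ℝ → ℝ) (γ δ : ℝ),
      ScaleAssumptions P f γ δ →
        (∀ n : ℕ, 2 ≤ n → ∃! c : Fin n → ℝ, IsScaleBLUE P c) ∧
        (∃ C : ℝ, ∀ n : ℕ, 2 ≤ n → ∀ c : Fin n → ℝ, IsScaleBLUE P c →
          ∀ θ₁ θ₂ : ℝ, 0 < θ₂ →
            Var[maxStat c; sampleLaw P θ₁ θ₂] ≤ C * θ₂ ^ 2 / Real.log n) ∧
        (∀ c : (n : ℕ) → Fin n → ℝ, (∀ n : ℕ, 2 ≤ n → IsScaleBLUE P (c n)) →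
          ∀ θ₁ θ₂ : ℝ, 0 < θ₂ →
            TendstoInMeasure (sampleLaw P θ₁ θ₂) (fun n => maxStat (c n)) atTop
              (fun _ => θ₂))) ∧
    (∀ l : ℝ, 0 < l → IsCovered (powerCdf l) 0 0) ∧
    IsCovered logisticCdf 1 0 ∧
    (∀ a : ℝ, 2 < a → IsCovered (paretoCdf a) (1 + 1 / a) 0) ∧
    IsCovered negExpCdf 0 0 ∧
    (∀ c : ℝ, 1 ≤ c → IsCovered (weibullCdf c) 1 (1 - 1 / c)) ∧
    IsCovered gumbelCdf 1 0 ∧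
    IsCovered normalCdf 1 (1 / 2) := by
  exact ⟨fun P _ f γ δ h => h.blue, fun l hl => isCovered_powerCdf hl, isCovered_logisticCdf,
    fun a ha => isCovered_paretoCdf ha, isCovered_negExpCdf, fun c hc => isCovered_weibullCdf hc,
    isCovered_gumbelCdf, isCovered_normalCdf⟩
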